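/- Let $M$ be a compact orientable smooth manifold of real dimension $2n$, $\mathrm{vol}$ a volume form on $M$ and $H$ a real closed $3$-form; put $d_H=d+H\wedge$. A section $e=X+\xi$ of $(T_M\oplus T_M^*)^{\mathbb C}$ acts on complex forms by $e\cdot\alpha=i_X\alpha+\xi\wedge\alpha$; put $\langle X+\xi,Y+\theta\rangle=\frac12(\xi(Y)+\theta(X))$, $\langle\alpha,\beta\rangle_s=(\alpha\wedge\sigma\beta)_{[2n]}$, where $\sigma$ is $+1$ in degrees $0,1$ and $-1$ in degrees $2,3$ modulo $4$, and $L^H_e=d_H\circ e+e\circ d_H$. Let $(\mathcal J_\phi,\mathcal J_\psi)$ be an almost generalized Kähler structure on $M$, i.e. a pair of commuting orthogonal endomorphisms of $T_M\oplus T_M^*$ with square $-1$ such that $\langle-\mathcal J_\phi\mathcal J_\psi e,e\rangle>0$ for $e\ne0$ (in particular, any $H$-twisted generalized Kähler structure). Let $\phi=\{\phi_\alpha\}$, $\psi=\{\psi_\alpha\}$ be smooth local trivializations, over an open cover $\{U_\alpha\}$ of $M$, of their canonical line bundles by nondegenerate pure spinors ($\mathcal J_\phi=-\sqrt{-1}$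 on $\ker\phi_\alpha$, $\mathcal J_\psi=-\sqrt{-1}$ on $\ker\psi_\alpha$), normalized by $i^{-n}\langle\phi_\alpha,\overline\phi_\alpha\rangle_s=i^{-n}\langle\psi_\alpha,\overline\psi_\alpha\rangle_s=\mathrm{vol}$. Write $d_H\phi_\alpha=(\eta_\alpha+N_\phi)\cdot\phi_\alpha$ and $d_H\psi_\alpha=(\zeta_\alpha+N_\psi)\cdot\psi_\alpha$ with $\eta_\alpha,\zeta_\alpha\in\sqrt{-1}(T_M\oplus T_M^*)$ and $N_\phi$, $N_\psi$ real sections of $\wedge^3(T_M\oplus T_M^*)$ of type $(3,0)+(0,3)$ with respect to $\mathcal J_\phi$, $\mathcal J_\psi$. The scalar curvature $S(\mathcal J_\phi,\mathcal J_\psi;\mathrm{vol})$ is the real function, independent of the normalized trivializations, given by $$S(\mathcal J_\phi,\mathcal J_\psi;\mathrm{vol})\,\mathrm{vol}=\mathrm{Re}\big(i^{-n}\langle\psi_\alpha,L^H_{\eta_\alpha}\overline\psi_\alpha\rangle_s+i^{-n}\langle\phi_\alpha,L^H_{\zeta_\alpha}\overline\phi_\alpha\rangle_s\big)+2\langle\zeta_\alpha,\eta_\alpha\rangle\,\mathrm{vol}.$$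 Let $\widetilde{\mathrm{Diff}}_0(M,H)$ be the group of all $g=e^bF$, with $F$ a diffeomorphism in the identity component of $\mathrm{Diff}(M)$ and $b$ a real $2$-form, such that the action $g\cdot\omega=e^b\wedge F^*\omega$ on differential forms satisfies $d_H\circ g=g\circ d_H$ (equivalently, $db=F^*H-H$). For every $g=e^bF\in\widetilde{\mathrm{Diff}}_0(M,H)$, the families $g\cdot\phi=\{e^b\wedge F^*\phi_\alpha\}$ and $g\cdot\psi=\{e^b\wedge F^*\psi_\alpha\}$ over the cover $\{F^{-1}(U_\alpha)\}$ are local trivializations, normalized by $F^*\mathrm{vol}$, of the canonical line bundles of an almost generalized Kähler structure $(\mathcal J_{g\cdot\phi},\mathcal J_{g\cdot\psi})$, and $$S(\mathcal J_{g\cdot\phi},\mathcal J_{g\cdot\psi};F^*\mathrm{vol})\,F^*\mathrm{vol}=F^*\big(S(\mathcal J_\phi,\mathcal J_\psi;\mathrm{vol})\,\mathrm{vol}\big).$$ -/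

import Mathlib

open scoped TensorProduct ContDiff Manifold

noncomputable section

namespace GenKahler

/-! ## Linear algebra on one real vector space `V` (later: a tangent space) -/

section Linear

variable (V W : Type*) [AddCommGroup V] [Module ℝ V] [AddCommGroup W] [Module ℝ W]

/-- Real forms of mixed degree on `V`: the exterior algebra of the dual of `V`. -/
abbrev RForm := ExteriorAlgebra ℝ (Module.Dual ℝ V)

/-- Complex forms of mixed degree on `V`, i.e. `⋀ V^* ⊗ ℂ`, the spin representation. -/
abbrev CForm := ℂ ⊗[ℝ] RForm V

/-- The generalized tangent space `V ⊕ V^*`; an element `X + ξ` is stored as `(ξ, X)`. -/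
abbrev GT := Module.Dual ℝ V × V

/-- The complexification `(V ⊕ V^*)^ℂ`. -/
abbrev GTC := ℂ ⊗[ℝ] GT V

/-- Complex conjugation on the complexification `ℂ ⊗ W` of a real vector space `W`. -/
def conjC : (ℂ ⊗[ℝ] W) →ₗ[ℝ] (ℂ ⊗[ℝ] W) :=
  LinearMap.rTensor W Complex.conjAe.toLinearMap

/-- The real part `ℂ ⊗ W → W`. -/
def reC : (ℂ ⊗[ℝ] W) →ₗ[ℝ] W :=
  (TensorProduct.lid ℝ W).toLinearMap ∘ₗ LinearMap.rTensor W Complex.reLm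

variable {V W}

/-- A real form regarded as a complex form. -/
def ofR (α : RForm V) : CForm V := (1 : ℂ) ⊗ₜ[ℝ] α

/-- Pullback of real forms under a linear map. -/
def pullR (A : V →ₗ[ℝ] W) : RForm W →ₐ[ℝ] RForm V := ExteriorAlgebra.map A.dualMap

/-- Pullback of complex forms under a linear map. -/
def pullC (A : V →ₗ[ℝ] W) : CForm W →ₗ[ℂ] CForm V :=
  LinearMap.baseChange ℂ (pullR A).toLinearMap

/-- The symmetric pairing `⟨X + ξ, Y + η⟩ = (ξ(Y) + η(X)) / 2`. -/
def pairing : LinearMap.BilinForm ℝ (GT V) := (1 / 2 : ℝ) • LinearMap.dualProd ℝ V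

/-- The complex bilinear extension of the pairing. -/
def pairingC : LinearMap.BilinForm ℂ (GTC V) := LinearMap.BilinForm.baseChange ℂ (pairing (V := V))

/-- The action of `X + ξ` on real forms, `α ↦ i_X α + ξ ∧ α`. -/
def actR : GT V →ₗ[ℝ] Module.End ℝ (RForm V) where
  toFun e := CliffordAlgebra.contractLeft (Module.Dual.eval ℝ V e.2) +
    LinearMap.mulLeft ℝ (ExteriorAlgebra.ι ℝ e.1)
  map_add' e f := by
    refine LinearMap.ext fun α => ?_
    simp only [Prod.snd_add, Prod.fst_add, map_add, LinearMap.add_apply, LinearMap.mulLeft_apply,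
      add_mul]
    abel
  map_smul' c e := by
    refine LinearMap.ext fun α => ?_
    simp [smul_add]

/-- The square of `X + ξ` acts by `⟨X + ξ, X + ξ⟩ = ξ(X)`. -/
theorem actR_sq (e : GT V) :
    actR e * actR e = algebraMap ℝ (Module.End ℝ (RForm V)) (QuadraticForm.dualProd ℝ V e) := by
  refine LinearMap.ext fun α => ?_
  have h1 : CliffordAlgebra.contractLeft (Module.Dual.eval ℝ V e.2)
      (CliffordAlgebra.contractLeft (Module.Dual.eval ℝ V e.2) α) = 0 :=
    CliffordAlgebra.contractLeft_contractLeft _ _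
  have h2 : CliffordAlgebra.contractLeft (Module.Dual.eval ℝ V e.2)
      (ExteriorAlgebra.ι ℝ e.1 * α) = (e.1 e.2) • α - ExteriorAlgebra.ι ℝ e.1 *
        (CliffordAlgebra.contractLeft (Module.Dual.eval ℝ V e.2) α) :=
    CliffordAlgebra.contractLeft_ι_mul _ _ _
  have h3 : ExteriorAlgebra.ι ℝ e.1 * (ExteriorAlgebra.ι ℝ e.1 * α) = 0 := by
    rw [← mul_assoc, ExteriorAlgebra.ι_sq_zero, zero_mul]
  simp only [actR, LinearMap.coe_mk, AddHom.coe_mk, Module.End.mul_apply, LinearMap.add_apply,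
    LinearMap.mulLeft_apply, mul_add, h1, h2, h3, Module.algebraMap_end_apply,
    QuadraticForm.dualProd_apply]
  abel

/-- The spin representation of the real Clifford algebra of `V ⊕ V^*` on real forms. -/
def spinR : CliffordAlgebra (QuadraticForm.dualProd ℝ V) →ₐ[ℝ] Module.End ℝ (RForm V) :=
  CliffordAlgebra.lift _ ⟨actR, actR_sq⟩

/-- The action of a real Clifford element on complex forms. -/
def spinC (N : CliffordAlgebra (QuadraticForm.dualProd ℝ V)) : CForm V →ₗ[ℂ] CForm V :=
  LinearMap.baseChange ℂ (spinR N)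

/-- The action `e · Φ` of `e ∈ (V ⊕ V^*)^ℂ` on a complex form `Φ`. -/
def act : GTC V →ₗ[ℂ] CForm V →ₗ[ℂ] CForm V :=
  LinearMap.liftBaseChange ℂ ((LinearMap.baseChangeHom ℝ ℂ (RForm V) (RForm V)) ∘ₗ actR)

/-- The involution `σ`: it is `+1` in degrees `0, 1` and `-1` in degrees `2, 3` modulo `4`. -/
def sigma : CForm V →ₗ[ℂ] CForm V :=
  LinearMap.baseChange ℂ (CliffordAlgebra.reverse (Q := (0 : QuadraticForm ℝ (Module.Dual ℝ V))))

/-- The component of degree `k`. -/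
def comp (k : ℕ) : CForm V →ₗ[ℂ] CForm V :=
  LinearMap.baseChange ℂ (GradedAlgebra.proj (fun i : ℕ ↦ ⋀[ℝ]^i (Module.Dual ℝ V)) k)

/-- The pairing `⟨α, β⟩_s = (α ∧ σ β)_{[m]}` of spinors, with `m = dim V`. -/
def spinPairing (α β : CForm V) : CForm V := comp (Module.finrank ℝ V) (α * sigma β)

/-- `ker Φ = {e ∈ (V ⊕ V^*)^ℂ | e · Φ = 0}`. -/
def spinorKer (Φ : CForm V) : Submodule ℂ (GTC V) := LinearMap.ker (act.flip Φ)

/-- The degree involution, `(-1)^k` in degree `k`. -/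
def parity : CForm V →ₗ[ℂ] CForm V :=
  LinearMap.baseChange ℂ
    (CliffordAlgebra.involute (Q := (0 : QuadraticForm ℝ (Module.Dual ℝ V)))).toLinearMap

/-- Pure spinors: nonzero forms of even or odd type whose kernel, which is isotropic, has the
maximal dimension `dim V`. -/
structure IsPure (Φ : CForm V) : Prop where
  ne_zero : Φ ≠ 0
  even_or_odd : parity Φ = Φ ∨ parity Φ = -Φ
  finrank_ker : Module.finrank ℂ (spinorKer Φ) = Module.finrank ℝ V

/-- `ker Φ` meets its complex conjugate only in `0`. -/
def IsNondegenerate (Φ : CForm V) : Prop :=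
  ∀ e ∈ spinorKer Φ, conjC (GT V) e ∈ spinorKer Φ → e = 0

/-- `J = J_Φ`: `J` is `-√-1` on `ker Φ` and `√-1` on its conjugate. For a nondegenerate pure
spinor this determines the real endomorphism `J`. -/
def Induces (Φ : CForm V) (J : GT V →ₗ[ℝ] GT V) : Prop :=
  ∀ e ∈ spinorKer Φ, LinearMap.baseChange ℂ J e = -(Complex.I • e) ∧
    LinearMap.baseChange ℂ J (conjC (GT V) e) = Complex.I • conjC (GT V) e

/-- An almost generalized complex structure on `V`. -/
structure IsAlmostGC (J : GT V →ₗ[ℝ] GT V) : Prop where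
  sq : ∀ e, J (J e) = -e
  orth : ∀ e f, pairing (J e) (J f) = pairing e f

/-- An almost generalized Kähler structure on `V`: two commuting almost generalized complex
structures such that `⟨-J₁ J₂ e, e⟩` is positive definite. -/
structure IsAlmostGK (J₁ J₂ : GT V →ₗ[ℝ] GT V) : Prop where
  left : IsAlmostGC J₁
  right : IsAlmostGC J₂
  comm : ∀ e, J₁ (J₂ e) = J₂ (J₁ e)
  pos : ∀ e, e ≠ 0 → 0 < pairing (-(J₁ (J₂ e))) e

/-- The real elements of `⋀³ L ⊕ ⋀³ L̄`, where `L = {v + √-1 J v}` is the `-√-1`-eigenspace of `J`.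
They are spanned by the real parts of the products `l₁ l₂ l₃`, `lⱼ = vⱼ + √-1 J vⱼ`. Since `L` is
isotropic, such a product in the Clifford algebra is the exterior product. -/
def nijenhuisSpace (J : GT V →ₗ[ℝ] GT V) :
    Submodule ℝ (CliffordAlgebra (QuadraticForm.dualProd ℝ V)) :=
  let c := CliffordAlgebra.ι (QuadraticForm.dualProd ℝ V)
  Submodule.span ℝ {N | ∃ u v w : GT V, N = c u * c v * c w - c u * c (J v) * c (J w) -
    c (J u) * c v * c (J w) - c (J u) * c (J v) * c w}

/-- Transport of `X + ξ` from `W ⊕ W^*` to `V ⊕ V^*` along `A : V → W` with inverse `B`. -/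
def gtPull (A : V →ₗ[ℝ] W) (B : W →ₗ[ℝ] V) : GT W →ₗ[ℝ] GT V := A.dualMap.prodMap B

instance exteriorAlgebra_finite (U : Type*) [AddCommGroup U] [Module ℝ U] [FiniteDimensional ℝ U] :
    Module.Finite ℝ (ExteriorAlgebra ℝ U) := by
  have key : (⊤ : Submodule ℝ (ExteriorAlgebra ℝ U)) =
      ⨆ i ∈ Finset.range (Module.finrank ℝ U + 1), ⋀[ℝ]^i U := by
    symm
    rw [eq_top_iff, ← (DirectSum.Decomposition.isInternal
      (fun i : ℕ ↦ ⋀[ℝ]^i U)).submodule_iSup_eq_top]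
    refine iSup_le fun i => ?_
    by_cases hi : i ∈ Finset.range (Module.finrank ℝ U + 1)
    · exact le_iSup₂_of_le i hi le_rfl
    · have h0 : Module.finrank ℝ (⋀[ℝ]^i U) = 0 := by
        rw [exteriorPower.finrank_eq]
        exact Nat.choose_eq_zero_of_lt (by simpa using hi)
      rw [Submodule.finrank_eq_zero.mp h0]
      exact bot_le
  rw [Module.finite_def, key]
  refine Submodule.fg_biSup _ _ fun i _ => ?_
  exact Module.Finite.iff_fg.mp inferInstance

end Linear

/-! ## Calculus on the model space -/

section Calculus

variable {E : Type*} [NormedAddCommGroup E] [NormedSpace ℝ E]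
variable {W : Type*} [AddCommGroup W] [Module ℝ W]

/-- Smoothness on `s` of a function with values in a finite-dimensional real vector space: all
linear coordinates are smooth. -/
def SmoothOn (f : E → W) (s : Set E) : Prop :=
  ∀ l : W →ₗ[ℝ] ℝ, ContDiffOn ℝ ∞ (fun y => l (f y)) s

/-- The derivative of `f` at `y` in the direction `v`, taken coordinatewise (it does not depend on
the basis). -/
def dirDeriv [Module.Finite ℝ W] (f : E → W) (y v : E) : W :=
  ∑ i, (fderiv ℝ (fun z => (Module.finBasis ℝ W).repr (f z) i) y v) • Module.finBasis ℝ W i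

/-- The exterior derivative `∑ dxᵢ ∧ ∂ᵢ τ` on `ℝ^m`. -/
def extD {m : ℕ} (τ : EuclideanSpace ℝ (Fin m) → CForm (EuclideanSpace ℝ (Fin m)))
    (y : EuclideanSpace ℝ (Fin m)) : CForm (EuclideanSpace ℝ (Fin m)) :=
  ∑ i : Fin m, ofR (ExteriorAlgebra.ι ℝ
      ((EuclideanSpace.proj i : EuclideanSpace ℝ (Fin m) →L[ℝ] ℝ).toLinearMap)) *
    dirDeriv τ y (EuclideanSpace.single i 1)

end Calculus

/-! ## Manifolds -/

section Manifold

variable {n : ℕ} {M : Type*} [TopologicalSpace M] [ChartedSpace (EuclideanSpace ℝ (Fin (2 * n))) M]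

/-- The tangent space of the `2n`-dimensional manifold `M` at `x`. -/
abbrev T (n : ℕ) {M : Type*} [TopologicalSpace M]
    [ChartedSpace (EuclideanSpace ℝ (Fin (2 * n))) M] (x : M) := TangentSpace (𝓡 (2 * n)) x

variable (n M)

/-- Fields of real forms. -/
abbrev RField := ∀ x : M, RForm (T n x)

/-- Fields of complex forms. -/
abbrev CField := ∀ x : M, CForm (T n x)

/-- Sections of `(T ⊕ T^*)^ℂ`. -/
abbrev GTField := ∀ x : M, GTC (T n x)

/-- Fields of endomorphisms of `T ⊕ T^*`. -/
abbrev JField := ∀ x : M, GT (T n x) →ₗ[ℝ] GT (T n x)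

variable {n M}

/-- The derivative at `x` of the chart around `p`. -/
def dChart (n : ℕ) {M : Type*} [TopologicalSpace M]
    [ChartedSpace (EuclideanSpace ℝ (Fin (2 * n))) M] (p x : M) :
    T n x →ₗ[ℝ] EuclideanSpace ℝ (Fin (2 * n)) :=
  (mfderiv (𝓡 (2 * n)) 𝓘(ℝ, EuclideanSpace ℝ (Fin (2 * n))) (extChartAt (𝓡 (2 * n)) p)
    x).toLinearMap

/-- The derivative at `y` of the inverse of the chart around `p`. -/
def dChartInv {M : Type*} [TopologicalSpace M]
    [ChartedSpace (EuclideanSpace ℝ (Fin (2 * n))) M] (p : M) (y : EuclideanSpace ℝ (Fin (2 * n))) :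
    EuclideanSpace ℝ (Fin (2 * n)) →ₗ[ℝ] T n ((extChartAt (𝓡 (2 * n)) p).symm y) :=
  (mfderiv 𝓘(ℝ, EuclideanSpace ℝ (Fin (2 * n))) (𝓡 (2 * n)) (extChartAt (𝓡 (2 * n)) p).symm
    y).toLinearMap

/-- A field of complex forms, written in the chart around `p`. -/
def inChart (τ : CField n M) (p : M) (y : EuclideanSpace ℝ (Fin (2 * n))) :
    CForm (EuclideanSpace ℝ (Fin (2 * n))) :=
  pullC (dChartInv p y) (τ ((extChartAt (𝓡 (2 * n)) p).symm y))

/-- A section of `(T ⊕ T^*)^ℂ`, written in the chart around `p`. -/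
def gtInChart (e : GTField n M) (p : M) (y : EuclideanSpace ℝ (Fin (2 * n))) :
    GTC (EuclideanSpace ℝ (Fin (2 * n))) :=
  LinearMap.baseChange ℂ (gtPull (dChartInv p y)
    (dChart n p ((extChartAt (𝓡 (2 * n)) p).symm y))) (e ((extChartAt (𝓡 (2 * n)) p).symm y))

/-- The part of the chart around `p` that corresponds to `U`. -/
def chartDomain (n : ℕ) {M : Type*} [TopologicalSpace M]
    [ChartedSpace (EuclideanSpace ℝ (Fin (2 * n))) M] (p : M) (U : Set M) :
    Set (EuclideanSpace ℝ (Fin (2 * n))) :=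
  (extChartAt (𝓡 (2 * n)) p).target ∩ (extChartAt (𝓡 (2 * n)) p).symm ⁻¹' U

/-- Smoothness of a field of complex forms on an open set `U`. -/
def FormSmoothOn (U : Set M) (τ : CField n M) : Prop :=
  ∀ p : M, SmoothOn (inChart τ p) (chartDomain n p U)

/-- Smoothness of a section of `(T ⊕ T^*)^ℂ` on an open set `U`. -/
def GTSmoothOn (U : Set M) (e : GTField n M) : Prop :=
  ∀ p : M, SmoothOn (gtInChart e p) (chartDomain n p U)

/-- Smooth real differential forms of degree `k` on `M`. -/
structure IsRealForm (k : ℕ) (α : RField n M) : Prop where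
  degree : ∀ x, α x ∈ ⋀[ℝ]^k (Module.Dual ℝ (T n x))
  smooth : FormSmoothOn Set.univ (fun x => ofR (α x))

/-- The exterior derivative on `M`, computed at `x` in the chart around `x`. -/
def d (τ : CField n M) : CField n M := fun x =>
  pullC (dChart n x x) (extD (inChart τ x) (extChartAt (𝓡 (2 * n)) x x))

/-- The twisted differential `d_H = d + H ∧`. -/
def dTw (H : RField n M) (τ : CField n M) : CField n M := fun x => d τ x + ofR (H x) * τ x

/-- The pointwise action of a section of `(T ⊕ T^*)^ℂ` on a field of forms. -/
def actF (e : GTField n M) (τ : CField n M) : CField n M := fun x => act (e x) (τ x)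

/-- The `H`-twisted Lie derivative `L^H_e = d_H e + e d_H`. -/
def lieTw (H : RField n M) (e : GTField n M) (τ : CField n M) : CField n M := fun x =>
  dTw H (actF e τ) x + act (e x) (dTw H τ x)

/-- The complex conjugate field of forms. -/
def conjF (τ : CField n M) : CField n M := fun x => conjC _ (τ x)

/-- Closed real `3`-forms. -/
structure IsClosedThreeForm (H : RField n M) : Prop extends IsRealForm 3 H where
  closed : d (fun x => ofR (H x)) = 0

/-- Volume forms: nowhere vanishing smooth real forms of top degree. -/
structure IsVolumeForm (vol : RField n M) : Prop extends IsRealForm (2 * n) vol where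
  ne_zero : ∀ x, vol x ≠ 0

/-- `φ` is, on the open set `U`, a smooth local trivialization of the canonical line bundle of `J`
by nondegenerate pure spinors, normalized by `i⁻ⁿ ⟨φ, φ̄⟩_s = vol`. -/
structure IsTrivialization (U : Set M) (φ : CField n M) (J : JField n M) (vol : RField n M) :
    Prop where
  smooth : FormSmoothOn U φ
  pure : ∀ x ∈ U, IsPure (φ x)
  nondegenerate : ∀ x ∈ U, IsNondegenerate (φ x)
  induces : ∀ x ∈ U, Induces (φ x) (J x)
  normalized : ∀ x ∈ U,
    (Complex.I ^ n)⁻¹ • spinPairing (φ x) (conjC _ (φ x)) = ofR (vol x)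

/-- On `U`, `η` is a smooth purely imaginary section of `(T ⊕ T^*)^ℂ` with
`d_H φ = (η + N) · φ` for a real `3`-tensor `N`, the Nijenhuis tensor, of type `(3,0) + (0,3)` with
respect to `J`. -/
structure IsConnectionTerm (H : RField n M) (U : Set M) (φ : CField n M) (J : JField n M)
    (η : GTField n M) : Prop where
  smooth : GTSmoothOn U η
  imaginary : ∀ x ∈ U, conjC _ (η x) = -η x
  eq : ∀ x ∈ U, ∃ N ∈ nijenhuisSpace (J x), dTw H φ x = act (η x) (φ x) + spinC N (φ x)

/-- The real top form
`Re (i⁻ⁿ ⟨ψ, L^H_η ψ̄⟩_s + i⁻ⁿ ⟨φ, L^H_ζ φ̄⟩_s) + 2 ⟨ζ, η⟩ vol`. The number `⟨ζ, η⟩` is real when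
`ζ` and `η` are purely imaginary. -/
def curvatureForm (H : RField n M) (vol : RField n M) (φ ψ : CField n M) (η ζ : GTField n M) :
    RField n M := fun x =>
  reC _ ((Complex.I ^ n)⁻¹ • spinPairing (ψ x) (lieTw H η (conjF ψ) x) +
    (Complex.I ^ n)⁻¹ • spinPairing (φ x) (lieTw H ζ (conjF φ) x)) +
  (2 * (pairingC (ζ x) (η x)).re) • vol x

/-- `s` is the value at `x` of the scalar curvature of `(J₁, J₂)` with respect to `vol`, computed
from some normalized local trivializations near `x`. -/
def IsScalarCurvatureAt (H : RField n M) (J₁ J₂ : JField n M) (vol : RField n M) (x : M) (s : ℝ) :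
    Prop :=
  ∃ (U : Set M) (φ ψ : CField n M) (η ζ : GTField n M), IsOpen U ∧ x ∈ U ∧
    IsTrivialization U φ J₁ vol ∧ IsTrivialization U ψ J₂ vol ∧
    IsConnectionTerm H U φ J₁ η ∧ IsConnectionTerm H U ψ J₂ ζ ∧
    s • vol x = curvatureForm H vol φ ψ η ζ x

/-- The scalar curvature `S(J₁, J₂)` with respect to the volume form `vol`: its value at `x` is the
number computed from normalized local trivializations near `x`, which does not depend on them. -/
def scalarCurvature (H : RField n M) (J₁ J₂ : JField n M) (vol : RField n M) (x : M) : ℝ :=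
  Classical.epsilon (IsScalarCurvatureAt H J₁ J₂ vol x)

/-! ## Diffeomorphisms extended by `b`-fields -/

/-- Pullback of real forms under a diffeomorphism. -/
def pullback (F : M ≃ₘ⟮𝓡 (2 * n), 𝓡 (2 * n)⟯ M) (α : RField n M) : RField n M := fun x =>
  pullR (mfderiv (𝓡 (2 * n)) (𝓡 (2 * n)) F x).toLinearMap (α (F x))

/-- The identity component of the diffeomorphism group of a compact manifold: the diffeomorphisms
that are smoothly isotopic to the identity. -/
def IsInDiff₀ (F : M ≃ₘ⟮𝓡 (2 * n), 𝓡 (2 * n)⟯ M) : Prop :=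
  ∃ G : ℝ → M ≃ₘ⟮𝓡 (2 * n), 𝓡 (2 * n)⟯ M,
    ContMDiff (𝓘(ℝ, ℝ).prod (𝓡 (2 * n))) (𝓡 (2 * n)) ∞ (fun p : ℝ × M => G p.1 p.2) ∧
    G 0 = Diffeomorph.refl (𝓡 (2 * n)) M ∞ ∧ G 1 = F

variable (n M) in
/-- The elements `e^b F`, with `F` a diffeomorphism and `b` a real `2`-form. -/
structure ExtDiffeo where
  F : M ≃ₘ⟮𝓡 (2 * n), 𝓡 (2 * n)⟯ M
  b : RField n M
  isForm : IsRealForm 2 b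

/-- The action `g · τ = e^b ∧ F^* τ` of `g = e^b F` on forms. If `τ` is given on `U`, then `g · τ` is
given on `F⁻¹(U)`. -/
def ExtDiffeo.smul (g : ExtDiffeo n M) (τ : CField n M) : CField n M := fun x =>
  ofR (IsNilpotent.exp (g.b x)) *
    pullC (mfderiv (𝓡 (2 * n)) (𝓡 (2 * n)) g.F x).toLinearMap (τ (g.F x))

/-- The group of the `g = e^b F` with `F` in the identity component of the diffeomorphism group
such that `g` commutes with `d_H` on differential forms (that is, `db = F^* H - H`). -/
def extDiff₀ (H : RField n M) : Set (ExtDiffeo n M) :=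
  {g | IsInDiff₀ g.F ∧
    ∀ τ : CField n M, FormSmoothOn Set.univ τ → dTw H (g.smul τ) = g.smul (dTw H τ)}

end Manifold

end GenKahler

end

open scoped TensorProduct ContDiff Manifold

noncomputable section

namespace GenKahler

/-! ### Exterior algebra of a 2-form: its exponential, contraction, reversal and pullback. -/

section TwoForms

variable {V W : Type*} [AddCommGroup V] [Module ℝ V] [AddCommGroup W] [Module ℝ W]

/-! Every ingredient of the scalar curvature is natural under `g = e^b F`, so the proof transports
the data and checks the compatibilities.

On one tangent space, let `A` be the derivative of `F`. The map `α ↦ e^b ∧ A^*α` on spinors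
(`spinMap`) is compatible with `X + ξ ↦ A⁻¹X + A^*ξ - i_{A⁻¹X} b` on generalized tangent vectors
(`gtMap`). It intertwines the Clifford actions (`spinMap_act`, `spinMap_spinC`), because `i_X e^b =
(i_X b) ∧ e^b`. The vector map is a real isometry, since `b` is skew. Hence kernels, purity,
nondegeneracy, the induced endomorphisms, positivity and the type of the Nijenhuis term are all
carried along. The spin pairing only sees the pullback, because `σ(e^b) = e^{-b}` cancels `e^b`
(`spinPairing_spinMap`).

On the manifold, `g` is assumed to commute with `d_H` on global smooth forms, while the spinors are
only local. Since `d_H` depends only on germs (`dTw_congr`) and a local form can be cut off by a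
bump function (`FormSmoothOn.exists_global`), the commutation holds for local forms
(`CommutesWith.dTw_smul`). Applying `g` to `d_H φ = (η + N)·φ` then shows that the transported `η`
is the connection term of `g·φ`, and the curvature form pulls back. The chart computations supply
the smoothness that this needs.

The scalar curvature is chosen by `Classical.epsilon` among the admissible values at a point.
Transport by `g` and by its inverse shows that `F x` for the old data and `x` for the new data have
the same admissible values (`isScalarCurvatureAt_smul_iff`). The chosen values therefore agree, with
no appeal to existence or uniqueness of an admissible value. -/

@[elab_as_elim]
theorem twoForm_induction {P : RForm V → Prop} {b : RForm V}
    (hb : b ∈ ⋀[ℝ]^2 (Module.Dual ℝ V))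
    (hι : ∀ u v : Module.Dual ℝ V, P (ExteriorAlgebra.ι ℝ u * ExteriorAlgebra.ι ℝ v))
    (hadd : ∀ x y, P x → P y → P (x + y)) : P b := by
  rw [ExteriorAlgebra.exteriorPower, pow_two] at hb
  refine Submodule.mul_induction_on hb ?_ hadd
  rintro _ ⟨u, rfl⟩ _ ⟨v, rfl⟩
  exact hι u v

theorem ι_mul_comm (u v : Module.Dual ℝ V) :
    ExteriorAlgebra.ι ℝ u * ExteriorAlgebra.ι ℝ v =
      -(ExteriorAlgebra.ι ℝ v * ExteriorAlgebra.ι ℝ u) :=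
  eq_neg_of_add_eq_zero_left (ExteriorAlgebra.ι_add_mul_swap u v)

/-- Even elements are central: moving a 1-form past a product of two 1-forms costs two signs. -/
theorem twoForm_commute {b : RForm V} (hb : b ∈ ⋀[ℝ]^2 (Module.Dual ℝ V)) (α : RForm V) :
    Commute b α := by
  refine twoForm_induction hb (fun u v => ?_) (fun _ _ => Commute.add_left)
  induction α using ExteriorAlgebra.induction with
  | algebraMap r => exact (Algebra.commutes r _).symm
  | ι w =>
    rw [commute_iff_eq, mul_assoc, ι_mul_comm v w, mul_neg, ← mul_assoc, ι_mul_comm u w, neg_mul,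
      neg_neg, mul_assoc]
  | mul a c ha hc => exact ha.mul_right hc
  | add a c ha hc => exact ha.add_right hc

/-- The power lies in a degree above the dimension. The exponent is not sharp, but it does not
depend on `b`, so `e^b` is one fixed polynomial for a whole family of 2-forms; `SmoothOn.exp` relies
on this. -/
theorem twoForm_pow_eq_zero [FiniteDimensional ℝ V] {b : RForm V}
    (hb : b ∈ ⋀[ℝ]^2 (Module.Dual ℝ V)) :
    b ^ (Module.finrank ℝ (Module.Dual ℝ V) + 1) = 0 := by
  set N := Module.finrank ℝ (Module.Dual ℝ V) + 1
  have h1 : b ^ N ∈ ⋀[ℝ]^(2 * N) (Module.Dual ℝ V) := by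
    rw [ExteriorAlgebra.exteriorPower, pow_mul]
    exact Submodule.pow_mem_pow _ hb N
  have h0 : Module.finrank ℝ (⋀[ℝ]^(2 * N) (Module.Dual ℝ V)) = 0 := by
    rw [exteriorPower.finrank_eq]
    exact Nat.choose_eq_zero_of_lt (by omega)
  rw [Submodule.finrank_eq_zero.mp h0] at h1
  exact (Submodule.mem_bot ℝ).mp h1

theorem twoForm_isNilpotent [FiniteDimensional ℝ V] {b : RForm V}
    (hb : b ∈ ⋀[ℝ]^2 (Module.Dual ℝ V)) : IsNilpotent b :=
  ⟨_, twoForm_pow_eq_zero hb⟩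

theorem neg_twoForm {b : RForm V} (hb : b ∈ ⋀[ℝ]^2 (Module.Dual ℝ V)) :
    -b ∈ ⋀[ℝ]^2 (Module.Dual ℝ V) := Submodule.neg_mem _ hb

theorem pullR_mem (A : V →ₗ[ℝ] W) {k : ℕ} {α : RForm W} (hα : α ∈ ⋀[ℝ]^k (Module.Dual ℝ W)) :
    pullR A α ∈ ⋀[ℝ]^k (Module.Dual ℝ V) := by
  have h : (⋀[ℝ]^k (Module.Dual ℝ W)).map (pullR A).toLinearMap ≤ ⋀[ℝ]^k (Module.Dual ℝ V) := by
    rw [ExteriorAlgebra.exteriorPower, ExteriorAlgebra.exteriorPower, Submodule.map_pow]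
    refine pow_le_pow_left' ?_ k
    rintro _ ⟨_, ⟨u, rfl⟩, rfl⟩
    exact ⟨A.dualMap u, (ExteriorAlgebra.map_apply_ι _ _).symm⟩
  exact h (Submodule.mem_map_of_mem hα)

/-- Contraction of real forms with a vector. -/
abbrev contr (X : V) : RForm V →ₗ[ℝ] RForm V :=
  CliffordAlgebra.contractLeft (Module.Dual.eval ℝ V X)

theorem contr_ι_mul (X : V) (u : Module.Dual ℝ V) (α : RForm V) :
    contr X (ExteriorAlgebra.ι ℝ u * α) = u X • α - ExteriorAlgebra.ι ℝ u * contr X α :=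
  CliffordAlgebra.contractLeft_ι_mul _ _ _

theorem contr_algebraMap (X : V) (r : ℝ) : contr X (algebraMap ℝ (RForm V) r) = 0 :=
  CliffordAlgebra.contractLeft_algebraMap _ _ _

theorem contr_ι (X : V) (u : Module.Dual ℝ V) :
    contr X (ExteriorAlgebra.ι ℝ u) = algebraMap ℝ _ (u X) :=
  CliffordAlgebra.contractLeft_ι _ _ _

/-- The `1`-form `i_X b` of a `2`-form `b`. -/
def bContract (b : RForm V) : V →ₗ[ℝ] Module.Dual ℝ V where
  toFun X := ExteriorAlgebra.ιInv (contr X b)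
  map_add' X Y := by simp [contr]
  map_smul' c X := by simp [contr]

/-- `ιInv` merely extracts the degree-one part, so what has to be seen is that `i_X b` is purely of
degree one; for `u ∧ v` it is `u(X) v - v(X) u`. -/
theorem ι_bContract {b : RForm V} (hb : b ∈ ⋀[ℝ]^2 (Module.Dual ℝ V)) (X : V) :
    ExteriorAlgebra.ι ℝ (bContract b X) = contr X b := by
  suffices h : ∃ u, ExteriorAlgebra.ι ℝ u = contr X b by
    obtain ⟨u, hu⟩ := h
    change ExteriorAlgebra.ι ℝ (ExteriorAlgebra.ιInv (contr X b)) = _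
    rw [← hu, ExteriorAlgebra.ι_leftInverse]
  refine twoForm_induction hb (fun u v => ⟨u X • v - v X • u, ?_⟩) ?_
  · rw [contr_ι_mul, contr_ι, map_sub, map_smul, map_smul, ← Algebra.commutes, ← Algebra.smul_def]
  · rintro x y ⟨u, hu⟩ ⟨v, hv⟩
    exact ⟨u + v, by rw [map_add, map_add, hu, hv]⟩

theorem contr_pullR (B : V →ₗ[ℝ] W) (X : V) (α : RForm W) :
    contr X (pullR B α) = pullR B (contr (B X) α) := by
  induction α using CliffordAlgebra.left_induction with
  | algebraMap r =>
    have h : pullR B (algebraMap ℝ (RForm W) r) = algebraMap ℝ (RForm V) r := AlgHom.commutes _ _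
    change contr X (pullR B (algebraMap ℝ (RForm W) r)) =
      pullR B (contr (B X) (algebraMap ℝ (RForm W) r))
    rw [h, contr_algebraMap, contr_algebraMap, map_zero]
  | add x y hx hy => simp only [map_add, hx, hy]
  | ι_mul x u hx =>
    change contr X (pullR B (ExteriorAlgebra.ι ℝ u * x)) =
      pullR B (contr (B X) (ExteriorAlgebra.ι ℝ u * x))
    have h : pullR B (ExteriorAlgebra.ι ℝ u) = ExteriorAlgebra.ι ℝ (B.dualMap u) :=
      ExteriorAlgebra.map_apply_ι _ _
    rw [map_mul, h, contr_ι_mul, contr_ι_mul, map_sub, map_smul, map_mul, h, hx]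
    rfl

theorem bContract_pullR (B : V →ₗ[ℝ] W) {b : RForm W} (hb : b ∈ ⋀[ℝ]^2 (Module.Dual ℝ W))
    (X : V) : bContract (pullR B b) X = B.dualMap (bContract b (B X)) := by
  rw [← ExteriorAlgebra.ι_inj ℝ, ι_bContract (pullR_mem B hb), contr_pullR, ← ι_bContract hb]
  exact ExteriorAlgebra.map_apply_ι _ _

theorem bContract_neg (b : RForm V) (X : V) : bContract (-b) X = -bContract b X := by
  simp [bContract]

/-- Contraction is an antiderivation, and the sign disappears because `b` has even degree. -/
theorem contr_twoForm_mul {b : RForm V} (hb : b ∈ ⋀[ℝ]^2 (Module.Dual ℝ V)) (X : V)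
    (α : RForm V) : contr X (b * α) = contr X b * α + b * contr X α := by
  refine twoForm_induction hb (fun u v => ?_) (fun x y hx hy => ?_)
  · rw [mul_assoc, contr_ι_mul, contr_ι_mul, contr_ι_mul, contr_ι, mul_sub, sub_mul,
      mul_smul_comm, smul_mul_assoc, mul_assoc, mul_assoc, ← Algebra.smul_def, mul_smul_comm]
    abel
  · rw [add_mul, map_add, hx, hy, map_add, add_mul, add_mul]
    abel

theorem contr_twoForm_pow_mul {b : RForm V} (hb : b ∈ ⋀[ℝ]^2 (Module.Dual ℝ V)) (X : V) (k : ℕ)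
    (α : RForm V) :
    contr X (b ^ (k + 1) * α) = ((k + 1 : ℕ) : ℝ) • (contr X b * (b ^ k * α)) +
      b ^ (k + 1) * contr X α := by
  induction k generalizing α with
  | zero => simpa using contr_twoForm_mul hb X α
  | succ k ih =>
    have hc : contr X b * (b ^ k * (b * α)) = contr X b * (b ^ (k + 1) * α) := by
      rw [pow_succ, mul_assoc]
    have hc' : b ^ (k + 1) * (contr X b * α) = contr X b * (b ^ (k + 1) * α) := by
      rw [← mul_assoc, ((twoForm_commute hb (contr X b)).pow_left (k + 1)).eq, mul_assoc]
    rw [pow_succ b (k + 1), mul_assoc, ih, contr_twoForm_mul hb, mul_add, hc, hc',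
      Nat.cast_succ (k + 1), add_smul, one_smul, mul_assoc]
    abel

/-- Term by term, `i_X (b^(i+1)/(i+1)!) = (i_X b) ∧ b^i/i!`, since `b` is central. This identity is
why a `b`-field acts on the spin representation by the shift `ξ ↦ ξ - i_X b`. -/
theorem contr_exp_mul [FiniteDimensional ℝ V] {b : RForm V}
    (hb : b ∈ ⋀[ℝ]^2 (Module.Dual ℝ V)) (X : V) (α : RForm V) :
    contr X (IsNilpotent.exp b * α) =
      contr X b * (IsNilpotent.exp b * α) + IsNilpotent.exp b * contr X α := by
  obtain ⟨N, hN⟩ := twoForm_isNilpotent hb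
  -- Contraction lowers the index of the series by one, so `e^b` is written with `N + 1` terms
  -- before contraction and with `N` terms after it.
  have hN' : b ^ (N + 1) = 0 := by rw [pow_succ, hN, zero_mul]
  have key : ∀ i : ℕ, contr X ((((i + 1).factorial : ℚ)⁻¹ • b ^ (i + 1)) * α) =
      contr X b * (((i.factorial : ℚ)⁻¹ • b ^ i) * α) +
        (((i + 1).factorial : ℚ)⁻¹ • b ^ (i + 1)) * contr X α := by
    intro i
    rw [smul_mul_assoc, map_rat_smul, contr_twoForm_pow_mul hb, smul_add, smul_mul_assoc,
      smul_mul_assoc, mul_smul_comm, Nat.cast_smul_eq_nsmul, ← Nat.cast_smul_eq_nsmul ℚ, smul_smul,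
      Nat.factorial_succ]
    congr 2
    push_cast
    field_simp
  have e1 := IsNilpotent.exp_eq_sum hN'
  have e2 := IsNilpotent.exp_eq_sum hN
  calc contr X (IsNilpotent.exp b * α)
      = contr X b * ((∑ i ∈ Finset.range N, (i.factorial : ℚ)⁻¹ • b ^ i) * α) +
        (∑ i ∈ Finset.range (N + 1), (i.factorial : ℚ)⁻¹ • b ^ i) * contr X α := by
        rw [e1, Finset.sum_range_succ', add_mul, map_add, Finset.sum_mul, map_sum,
          Finset.sum_congr rfl fun i _ => key i, Finset.sum_add_distrib, ← Finset.mul_sum,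
          ← Finset.sum_mul, ← Finset.sum_mul, add_mul]
        simp [add_assoc]
    _ = _ := by rw [← e1, ← e2]

theorem pullR_exp [FiniteDimensional ℝ W] (A : V →ₗ[ℝ] W) {b : RForm W}
    (hb : b ∈ ⋀[ℝ]^2 (Module.Dual ℝ W)) :
    pullR A (IsNilpotent.exp b) = IsNilpotent.exp (pullR A b) :=
  IsNilpotent.map_exp (twoForm_isNilpotent hb) _

theorem exp_commute [FiniteDimensional ℝ V] {b : RForm V}
    (hb : b ∈ ⋀[ℝ]^2 (Module.Dual ℝ V)) (α : RForm V) : Commute (IsNilpotent.exp b) α := by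
  rw [IsNilpotent.exp]
  exact Commute.sum_left _ _ _ fun i _ => ((twoForm_commute hb α).pow_left i).smul_left _

/-- Reversal sends `u ∧ v` to `v ∧ u = -u ∧ v`, and it respects powers of a single element. -/
theorem reverse_exp [FiniteDimensional ℝ V] {b : RForm V}
    (hb : b ∈ ⋀[ℝ]^2 (Module.Dual ℝ V)) :
    CliffordAlgebra.reverse (Q := (0 : QuadraticForm ℝ (Module.Dual ℝ V))) (IsNilpotent.exp b) =
      IsNilpotent.exp (-b) := by
  have hr : CliffordAlgebra.reverse (Q := (0 : QuadraticForm ℝ (Module.Dual ℝ V))) b = -b := by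
    refine twoForm_induction hb (fun u v => ?_) (fun x y hx hy => ?_)
    · change CliffordAlgebra.reverse (CliffordAlgebra.ι _ u * CliffordAlgebra.ι _ v) = _
      rw [CliffordAlgebra.reverse.map_mul, CliffordAlgebra.reverse_ι, CliffordAlgebra.reverse_ι]
      exact ι_mul_comm v u
    · rw [map_add, hx, hy, neg_add]
  have hp : ∀ i : ℕ, CliffordAlgebra.reverse (Q := (0 : QuadraticForm ℝ (Module.Dual ℝ V)))
      (b ^ i) = (-b) ^ i := by
    intro i
    induction i with
    | zero => simp
    | succ i ih => rw [pow_succ, CliffordAlgebra.reverse.map_mul, ih, hr, ← pow_succ']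
  obtain ⟨N, hN⟩ := twoForm_isNilpotent hb
  have hN' : (-b) ^ N = 0 := by rw [neg_pow, hN, mul_zero]
  rw [IsNilpotent.exp_eq_sum hN, IsNilpotent.exp_eq_sum hN', map_sum]
  refine Finset.sum_congr rfl fun i _ => ?_
  rw [map_rat_smul, hp]

theorem involute_exp [FiniteDimensional ℝ V] {b : RForm V}
    (hb : b ∈ ⋀[ℝ]^2 (Module.Dual ℝ V)) :
    CliffordAlgebra.involute (Q := (0 : QuadraticForm ℝ (Module.Dual ℝ V))) (IsNilpotent.exp b) =
      IsNilpotent.exp b := by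
  have hr : CliffordAlgebra.involute (Q := (0 : QuadraticForm ℝ (Module.Dual ℝ V))) b = b := by
    refine twoForm_induction hb (fun u v => ?_) (fun x y hx hy => ?_)
    · change CliffordAlgebra.involute (CliffordAlgebra.ι (0 : QuadraticForm ℝ (Module.Dual ℝ V)) u *
        CliffordAlgebra.ι (0 : QuadraticForm ℝ (Module.Dual ℝ V)) v) = _
      rw [map_mul, CliffordAlgebra.involute_ι, CliffordAlgebra.involute_ι, neg_mul_neg]
    · rw [map_add, hx, hy]
  have := IsNilpotent.map_exp (twoForm_isNilpotent hb)
    (CliffordAlgebra.involute (Q := (0 : QuadraticForm ℝ (Module.Dual ℝ V))))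
  rw [hr] at this
  exact this

theorem reverse_pullR (A : V →ₗ[ℝ] W) (α : RForm W) :
    CliffordAlgebra.reverse (Q := (0 : QuadraticForm ℝ (Module.Dual ℝ V))) (pullR A α) =
      pullR A (CliffordAlgebra.reverse (Q := (0 : QuadraticForm ℝ (Module.Dual ℝ W))) α) := by
  induction α using ExteriorAlgebra.induction with
  | algebraMap r =>
    have h : pullR A (algebraMap ℝ (RForm W) r) = algebraMap ℝ (RForm V) r := AlgHom.commutes _ _
    have h1 : CliffordAlgebra.reverse (Q := (0 : QuadraticForm ℝ (Module.Dual ℝ W)))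
      (algebraMap ℝ (RForm W) r) = algebraMap ℝ (RForm W) r := CliffordAlgebra.reverse.commutes r
    rw [h, h1, h]
    exact CliffordAlgebra.reverse.commutes r
  | ι u =>
    have h : ∀ u, pullR A (ExteriorAlgebra.ι ℝ u) = ExteriorAlgebra.ι ℝ (A.dualMap u) :=
      ExteriorAlgebra.map_apply_ι _
    have h1 : CliffordAlgebra.reverse (Q := (0 : QuadraticForm ℝ (Module.Dual ℝ W)))
      (ExteriorAlgebra.ι ℝ u) = ExteriorAlgebra.ι ℝ u := CliffordAlgebra.reverse_ι u
    rw [h, h1, h]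
    exact CliffordAlgebra.reverse_ι _
  | mul a c ha hc =>
    rw [map_mul, CliffordAlgebra.reverse.map_mul, ha, hc, CliffordAlgebra.reverse.map_mul, map_mul]
  | add a c ha hc => simp only [map_add, ha, hc]

theorem involute_pullR (A : V →ₗ[ℝ] W) (α : RForm W) :
    CliffordAlgebra.involute (Q := (0 : QuadraticForm ℝ (Module.Dual ℝ V))) (pullR A α) =
      pullR A (CliffordAlgebra.involute (Q := (0 : QuadraticForm ℝ (Module.Dual ℝ W))) α) := by
  induction α using ExteriorAlgebra.induction with
  | algebraMap r =>
    have h : pullR A (algebraMap ℝ (RForm W) r) = algebraMap ℝ (RForm V) r := AlgHom.commutes _ _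
    have h1 : CliffordAlgebra.involute (Q := (0 : QuadraticForm ℝ (Module.Dual ℝ W)))
      (algebraMap ℝ (RForm W) r) = algebraMap ℝ (RForm W) r := AlgHom.commutes _ _
    rw [h, h1, h]
    exact AlgHom.commutes _ _
  | ι u =>
    have h : ∀ u, pullR A (ExteriorAlgebra.ι ℝ u) = ExteriorAlgebra.ι ℝ (A.dualMap u) :=
      ExteriorAlgebra.map_apply_ι _
    have h1 : CliffordAlgebra.involute (Q := (0 : QuadraticForm ℝ (Module.Dual ℝ W)))
      (ExteriorAlgebra.ι ℝ u) = -ExteriorAlgebra.ι ℝ u := CliffordAlgebra.involute_ι u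
    rw [h, h1, map_neg, h]
    exact CliffordAlgebra.involute_ι _
  | mul a c ha hc => simp only [map_mul, ha, hc]
  | add a c ha hc => simp only [map_add, ha, hc]

/-- Pullback preserves degree, so the claim reduces to homogeneous elements. -/
theorem proj_pullR (A : V →ₗ[ℝ] W) (k : ℕ) (α : RForm W) :
    GradedAlgebra.proj (fun i : ℕ ↦ ⋀[ℝ]^i (Module.Dual ℝ V)) k (pullR A α) =
      pullR A (GradedAlgebra.proj (fun i : ℕ ↦ ⋀[ℝ]^i (Module.Dual ℝ W)) k α) := by
  classical
  induction α using DirectSum.Decomposition.inductionOn (fun i : ℕ ↦ ⋀[ℝ]^i (Module.Dual ℝ W)) with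
  | zero => simp only [map_zero]
  | @homogeneous i m =>
    have hm := pullR_mem A m.2
    rw [GradedAlgebra.proj_apply, GradedAlgebra.proj_apply]
    by_cases h : i = k
    · subst h
      rw [DirectSum.decompose_of_mem_same (fun i : ℕ ↦ ⋀[ℝ]^i (Module.Dual ℝ V)) hm,
        DirectSum.decompose_of_mem_same (fun i : ℕ ↦ ⋀[ℝ]^i (Module.Dual ℝ W)) m.2]
    · rw [DirectSum.decompose_of_mem_ne (fun i : ℕ ↦ ⋀[ℝ]^i (Module.Dual ℝ V)) hm h,
        DirectSum.decompose_of_mem_ne (fun i : ℕ ↦ ⋀[ℝ]^i (Module.Dual ℝ W)) m.2 h, map_zero]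
  | add a c ha hc => simp only [map_add, ha, hc]

theorem pullR_comp {Z : Type*} [AddCommGroup Z] [Module ℝ Z] (A : V →ₗ[ℝ] W) (B : W →ₗ[ℝ] Z)
    (α : RForm Z) : pullR A (pullR B α) = pullR (B ∘ₗ A) α := by
  have h : (pullR A).comp (pullR B) = pullR (B ∘ₗ A) := by
    rw [pullR, pullR, pullR, ExteriorAlgebra.map_comp_map]
    rfl
  exact DFunLike.congr_fun h α

theorem pullR_id (α : RForm V) : pullR LinearMap.id α = α := by
  have h : pullR (LinearMap.id : V →ₗ[ℝ] V) = AlgHom.id ℝ _ := by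
    rw [pullR, LinearMap.dualMap_id, ExteriorAlgebra.map_id]
  exact DFunLike.congr_fun h α

end TwoForms

/-! ### Complexification of real linear maps. -/

section BaseChange

variable {P Q : Type*} [AddCommGroup P] [Module ℝ P] [AddCommGroup Q] [Module ℝ Q]

theorem conjC_baseChange (f : P →ₗ[ℝ] Q) (t : ℂ ⊗[ℝ] P) :
    conjC Q (LinearMap.baseChange ℂ f t) = LinearMap.baseChange ℂ f (conjC P t) := by
  induction t using TensorProduct.induction_on with
  | zero => simp only [map_zero]
  | tmul z p => rfl
  | add x y hx hy => simp only [map_add, hx, hy]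

theorem reC_baseChange (f : P →ₗ[ℝ] Q) (t : ℂ ⊗[ℝ] P) :
    reC Q (LinearMap.baseChange ℂ f t) = f (reC P t) := by
  induction t using TensorProduct.induction_on with
  | zero => simp only [map_zero]
  | tmul z p => simp [reC]
  | add x y hx hy => simp only [map_add, hx, hy]

theorem baseChange_baseChange {S : Type*} [AddCommGroup S] [Module ℝ S] (g : Q →ₗ[ℝ] S)
    (f : P →ₗ[ℝ] Q) (t : ℂ ⊗[ℝ] P) :
    LinearMap.baseChange ℂ g (LinearMap.baseChange ℂ f t) = LinearMap.baseChange ℂ (g ∘ₗ f) t := by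
  rw [LinearMap.baseChange_comp]
  rfl

theorem baseChange_id_apply (t : ℂ ⊗[ℝ] P) :
    LinearMap.baseChange ℂ (LinearMap.id : P →ₗ[ℝ] P) t = t := by
  rw [LinearMap.baseChange_id]
  rfl

end BaseChange

/-! ### Transport of spinors and generalized complex structures by `e^b A` on one vector space. -/

section Transport

variable {V W : Type*} [AddCommGroup V] [Module ℝ V] [AddCommGroup W] [Module ℝ W]

theorem act_tmul_tmul (z w : ℂ) (e : GT V) (α : RForm V) :
    act (z ⊗ₜ[ℝ] e) (w ⊗ₜ[ℝ] α) = (z * w) ⊗ₜ[ℝ] actR e α := by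
  simp [act, TensorProduct.smul_tmul']

/-- The action `α ↦ e^b ∧ A^* α` on real forms. -/
def spinMapR (A : V →ₗ[ℝ] W) (b : RForm V) : RForm W →ₗ[ℝ] RForm V :=
  LinearMap.mulLeft ℝ (IsNilpotent.exp b) ∘ₗ (pullR A).toLinearMap

/-- The action `α ↦ e^b ∧ A^* α` on complex forms. -/
def spinMap (A : V →ₗ[ℝ] W) (b : RForm V) : CForm W →ₗ[ℂ] CForm V :=
  LinearMap.baseChange ℂ (spinMapR A b)

theorem spinMapR_apply (A : V →ₗ[ℝ] W) (b : RForm V) (α : RForm W) :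
    spinMapR A b α = IsNilpotent.exp b * pullR A α := rfl

theorem pullC_tmul (A : V →ₗ[ℝ] W) (z : ℂ) (α : RForm W) :
    pullC A (z ⊗ₜ[ℝ] α) = z ⊗ₜ[ℝ] pullR A α := rfl

theorem pullC_ofR (A : V →ₗ[ℝ] W) (α : RForm W) : pullC A (ofR α) = ofR (pullR A α) := rfl

theorem pullC_comp {Z : Type*} [AddCommGroup Z] [Module ℝ Z] (A : V →ₗ[ℝ] W) (B : W →ₗ[ℝ] Z)
    (τ : CForm Z) : pullC A (pullC B τ) = pullC (B ∘ₗ A) τ := by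
  induction τ using TensorProduct.induction_on with
  | zero => simp only [map_zero]
  | tmul z α => rw [pullC_tmul, pullC_tmul, pullC_tmul, pullR_comp]
  | add x y hx hy => simp only [map_add, hx, hy]

theorem pullC_mul (A : V →ₗ[ℝ] W) (σ τ : CForm W) :
    pullC A (σ * τ) = pullC A σ * pullC A τ := by
  induction σ using TensorProduct.induction_on with
  | zero => simp only [map_zero, zero_mul]
  | add x y hx hy => simp only [map_add, add_mul, hx, hy]
  | tmul z α =>
    induction τ using TensorProduct.induction_on with
    | zero => simp only [map_zero, mul_zero]
    | add x y hx hy => simp only [map_add, mul_add, hx, hy]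
    | tmul w β =>
      simp only [Algebra.TensorProduct.tmul_mul_tmul, pullC_tmul, map_mul]

theorem spinMap_tmul (A : V →ₗ[ℝ] W) (b : RForm V) (z : ℂ) (α : RForm W) :
    spinMap A b (z ⊗ₜ[ℝ] α) = z ⊗ₜ[ℝ] spinMapR A b α := rfl

theorem spinMap_eq (A : V →ₗ[ℝ] W) (b : RForm V) (τ : CForm W) :
    spinMap A b τ = ofR (IsNilpotent.exp b) * pullC A τ := by
  induction τ using TensorProduct.induction_on with
  | zero => simp only [map_zero, mul_zero]
  | add x y hx hy => simp only [map_add, mul_add, hx, hy]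
  | tmul z α =>
    rw [spinMap_tmul, pullC_tmul, ofR, Algebra.TensorProduct.tmul_mul_tmul, one_mul, spinMapR_apply]

theorem conjC_spinMap (A : V →ₗ[ℝ] W) (b : RForm V) (τ : CForm W) :
    conjC _ (spinMap A b τ) = spinMap A b (conjC _ τ) := conjC_baseChange _ _

/-- The `b`-field transform `X + ξ ↦ X + ξ - i_X b`. -/
def bShift (b : RForm V) : GT V →ₗ[ℝ] GT V :=
  LinearMap.prod (LinearMap.fst ℝ _ _ - bContract b ∘ₗ LinearMap.snd ℝ _ _) (LinearMap.snd ℝ _ _)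

/-- The action of `e^b A` on `X + ξ`. -/
def gtMap (A : V ≃ₗ[ℝ] W) (b : RForm V) : GT W →ₗ[ℝ] GT V :=
  bShift b ∘ₗ gtPull A.toLinearMap A.symm.toLinearMap

theorem gtMap_apply (A : V ≃ₗ[ℝ] W) (b : RForm V) (e : GT W) :
    gtMap A b e = (A.toLinearMap.dualMap e.1 - bContract b (A.symm e.2), A.symm e.2) := rfl

theorem gtMap_symm_gtMap (A : V ≃ₗ[ℝ] W) {b : RForm V} (hb : b ∈ ⋀[ℝ]^2 (Module.Dual ℝ V))
    (e : GT W) : gtMap A.symm (-pullR A.symm.toLinearMap b) (gtMap A b e) = e := by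
  rw [gtMap_apply, gtMap_apply]
  refine Prod.ext (LinearMap.ext fun Y => ?_) (by simp)
  simp [bContract_neg, bContract_pullR _ hb]

theorem neg_pullR_symm (A : V ≃ₗ[ℝ] W) (b : RForm V) :
    -pullR A.toLinearMap (-pullR A.symm.toLinearMap b) = b := by
  rw [map_neg, neg_neg, pullR_comp, LinearEquiv.symm_comp, pullR_id]

theorem neg_pullR_symm_mem (A : V ≃ₗ[ℝ] W) {b : RForm V} (hb : b ∈ ⋀[ℝ]^2 (Module.Dual ℝ V)) :
    -pullR A.symm.toLinearMap b ∈ ⋀[ℝ]^2 (Module.Dual ℝ W) :=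
  neg_twoForm (pullR_mem _ hb)

theorem gtMap_gtMap_symm (A : V ≃ₗ[ℝ] W) {b : RForm V} (hb : b ∈ ⋀[ℝ]^2 (Module.Dual ℝ V))
    (e : GT V) : gtMap A b (gtMap A.symm (-pullR A.symm.toLinearMap b) e) = e := by
  -- The inverse of `(A, b)` is `(A⁻¹, -(A⁻¹)^* b)`, and the same recipe applied to the inverse
  -- gives `(A, b)` back, so one left-inverse lemma yields both sides.
  have h := gtMap_symm_gtMap A.symm (neg_pullR_symm_mem A hb) e
  rwa [LinearEquiv.symm_symm, neg_pullR_symm] at h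

/-- The two contributions of `b` are `b(X, Y)` and `b(Y, X)`, which cancel; contractions by two
vectors anticommute. -/
theorem pairing_gtMap (A : V ≃ₗ[ℝ] W) {b : RForm V} (hb : b ∈ ⋀[ℝ]^2 (Module.Dual ℝ V))
    (e f : GT W) : pairing (gtMap A b e) (gtMap A b f) = pairing e f := by
  have hskew : ∀ X Y : V, bContract b X Y = -bContract b Y X := by
    intro X Y
    have h : contr Y (contr X b) = -contr X (contr Y b) := CliffordAlgebra.contractLeft_comm _ _ _
    rw [← ι_bContract hb, ← ι_bContract hb, contr_ι, contr_ι, ← map_neg] at h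
    exact (ExteriorAlgebra.algebraMap_inj _ _ _).mp h
  have := hskew (A.symm e.2) (A.symm f.2)
  simp only [pairing, gtMap_apply, LinearMap.smul_apply, LinearMap.dualProd_apply_apply,
    LinearMap.sub_apply, LinearMap.dualMap_apply, LinearEquiv.coe_coe, LinearEquiv.apply_symm_apply]
  rw [this]
  congr 1
  ring

theorem dualProd_gtMap (A : V ≃ₗ[ℝ] W) {b : RForm V} (hb : b ∈ ⋀[ℝ]^2 (Module.Dual ℝ V))
    (e : GT W) : QuadraticForm.dualProd ℝ V (gtMap A b e) = QuadraticForm.dualProd ℝ W e := by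
  have h := pairing_gtMap A hb e e
  simp only [pairing, LinearMap.smul_apply, LinearMap.dualProd_apply_apply, smul_eq_mul] at h
  simp only [QuadraticForm.dualProd_apply]
  linarith

theorem pairingC_gtMap (A : V ≃ₗ[ℝ] W) {b : RForm V} (hb : b ∈ ⋀[ℝ]^2 (Module.Dual ℝ V))
    (e f : GTC W) :
    pairingC (LinearMap.baseChange ℂ (gtMap A b) e) (LinearMap.baseChange ℂ (gtMap A b) f) =
      pairingC e f := by
  induction e using TensorProduct.induction_on with
  | zero => simp only [map_zero, LinearMap.zero_apply]
  | add x y hx hy => simp only [map_add, LinearMap.add_apply, hx, hy]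
  | tmul z e =>
    induction f using TensorProduct.induction_on with
    | zero => simp only [map_zero]
    | add x y hx hy => simp only [map_add, hx, hy]
    | tmul w f =>
      simp only [pairingC, LinearMap.baseChange_tmul, LinearMap.BilinForm.baseChange_tmul,
        pairing_gtMap A hb]

/-- The isometry of the generalized tangent spaces given by `e^b A`. -/
def gtIsometry (A : V ≃ₗ[ℝ] W) {b : RForm V} (hb : b ∈ ⋀[ℝ]^2 (Module.Dual ℝ V)) :
    QuadraticMap.Isometry (QuadraticForm.dualProd ℝ W) (QuadraticForm.dualProd ℝ V) where
  toLinearMap := gtMap A b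
  map_app' := dualProd_gtMap A hb

/-- `e^b A` as an equivalence of generalized tangent spaces. -/
def gtEquiv (A : V ≃ₗ[ℝ] W) {b : RForm V} (hb : b ∈ ⋀[ℝ]^2 (Module.Dual ℝ V)) : GT W ≃ₗ[ℝ] GT V :=
  LinearEquiv.ofLinearMap (gtMap A b) (gtMap A.symm (-pullR A.symm.toLinearMap b))
    (LinearMap.ext (gtMap_gtMap_symm A hb)) (LinearMap.ext (gtMap_symm_gtMap A hb))

/-- The complexification of `gtEquiv`. -/
def gtEquivC (A : V ≃ₗ[ℝ] W) {b : RForm V} (hb : b ∈ ⋀[ℝ]^2 (Module.Dual ℝ V)) :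
    GTC W ≃ₗ[ℂ] GTC V :=
  (gtEquiv A hb).baseChange ℝ ℂ _ _

theorem gtEquivC_apply (A : V ≃ₗ[ℝ] W) {b : RForm V} (hb : b ∈ ⋀[ℝ]^2 (Module.Dual ℝ V))
    (e : GTC W) : gtEquivC A hb e = LinearMap.baseChange ℂ (gtMap A b) e := rfl

/-- Transport of an endomorphism by `e^b A`. -/
def gtConj (A : V ≃ₗ[ℝ] W) (b : RForm V) (J : GT W →ₗ[ℝ] GT W) : GT V →ₗ[ℝ] GT V :=
  gtMap A b ∘ₗ J ∘ₗ gtMap A.symm (-pullR A.symm.toLinearMap b)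

theorem gtConj_gtMap (A : V ≃ₗ[ℝ] W) {b : RForm V} (hb : b ∈ ⋀[ℝ]^2 (Module.Dual ℝ V))
    (J : GT W →ₗ[ℝ] GT W) (e : GT W) : gtConj A b J (gtMap A b e) = gtMap A b (J e) := by
  simp only [gtConj, LinearMap.comp_apply, gtMap_symm_gtMap A hb]

theorem gtConj_symm_gtConj (A : V ≃ₗ[ℝ] W) {b : RForm V} (hb : b ∈ ⋀[ℝ]^2 (Module.Dual ℝ V))
    (J : GT W →ₗ[ℝ] GT W) :
    gtConj A.symm (-pullR A.symm.toLinearMap b) (gtConj A b J) = J := by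
  refine LinearMap.ext fun e => ?_
  simp only [gtConj, LinearMap.comp_apply, LinearEquiv.symm_symm, neg_pullR_symm,
    gtMap_symm_gtMap A hb]

theorem IsAlmostGC.gtConj (A : V ≃ₗ[ℝ] W) {b : RForm V} (hb : b ∈ ⋀[ℝ]^2 (Module.Dual ℝ V))
    {J : GT W →ₗ[ℝ] GT W} (hJ : IsAlmostGC J) : IsAlmostGC (gtConj A b J) where
  sq e := by
    obtain ⟨e, rfl⟩ := (gtEquiv A hb).surjective e
    change GenKahler.gtConj A b J (GenKahler.gtConj A b J (gtMap A b e)) = -gtMap A b e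
    rw [gtConj_gtMap A hb, gtConj_gtMap A hb, hJ.sq, map_neg]
  orth e f := by
    obtain ⟨e, rfl⟩ := (gtEquiv A hb).surjective e
    obtain ⟨f, rfl⟩ := (gtEquiv A hb).surjective f
    change pairing (GenKahler.gtConj A b J (gtMap A b e)) (GenKahler.gtConj A b J (gtMap A b f)) =
      pairing (gtMap A b e) (gtMap A b f)
    rw [gtConj_gtMap A hb, gtConj_gtMap A hb, pairing_gtMap A hb, hJ.orth, pairing_gtMap A hb]

theorem IsAlmostGK.gtConj (A : V ≃ₗ[ℝ] W) {b : RForm V} (hb : b ∈ ⋀[ℝ]^2 (Module.Dual ℝ V))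
    {J K : GT W →ₗ[ℝ] GT W} (h : IsAlmostGK J K) : IsAlmostGK (gtConj A b J) (gtConj A b K) where
  left := h.left.gtConj A hb
  right := h.right.gtConj A hb
  comm e := by
    obtain ⟨e, rfl⟩ := (gtEquiv A hb).surjective e
    change GenKahler.gtConj A b J (GenKahler.gtConj A b K (gtMap A b e)) =
      GenKahler.gtConj A b K (GenKahler.gtConj A b J (gtMap A b e))
    simp only [gtConj_gtMap A hb, h.comm]
  pos e he := by
    obtain ⟨e, rfl⟩ := (gtEquiv A hb).surjective e
    have he' : e ≠ 0 := fun h0 => he (by rw [h0, map_zero])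
    change 0 < pairing (-(GenKahler.gtConj A b J (GenKahler.gtConj A b K (gtMap A b e))))
      (gtMap A b e)
    rw [gtConj_gtMap A hb, gtConj_gtMap A hb, ← map_neg, pairing_gtMap A hb]
    exact h.pos e he'

/-- The isometry induces an algebra map of Clifford algebras and intertwines `J` with its transport,
so it sends each spanning product to the spanning product of the transported vectors. -/
theorem map_mem_nijenhuisSpace (A : V ≃ₗ[ℝ] W) {b : RForm V}
    (hb : b ∈ ⋀[ℝ]^2 (Module.Dual ℝ V)) {J : GT W →ₗ[ℝ] GT W}
    {N : CliffordAlgebra (QuadraticForm.dualProd ℝ W)} (hN : N ∈ nijenhuisSpace J) :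
    CliffordAlgebra.map (gtIsometry A hb) N ∈ nijenhuisSpace (gtConj A b J) := by
  induction hN using Submodule.span_induction with
  | zero => simp only [map_zero, Submodule.zero_mem]
  | add x y _ _ hx hy => rw [map_add]; exact Submodule.add_mem _ hx hy
  | smul r x _ hx => rw [map_smul]; exact Submodule.smul_mem _ r hx
  | mem x hx =>
    obtain ⟨u, v, w, rfl⟩ := hx
    refine Submodule.subset_span ⟨gtMap A b u, gtMap A b v, gtMap A b w, ?_⟩
    simp only [map_sub, map_mul, CliffordAlgebra.map_apply_ι, gtConj_gtMap A hb]
    rfl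

theorem pullR_actR (A : V ≃ₗ[ℝ] W) (e : GT W) (α : RForm W) :
    pullR A.toLinearMap (actR e α) =
      actR (gtPull A.toLinearMap A.symm.toLinearMap e) (pullR A.toLinearMap α) := by
  change pullR A.toLinearMap (contr e.2 α + ExteriorAlgebra.ι ℝ e.1 * α) =
    contr (A.symm e.2) (pullR A.toLinearMap α) +
      ExteriorAlgebra.ι ℝ (A.toLinearMap.dualMap e.1) * pullR A.toLinearMap α
  have h : pullR A.toLinearMap (ExteriorAlgebra.ι ℝ e.1) =
    ExteriorAlgebra.ι ℝ (A.toLinearMap.dualMap e.1) := ExteriorAlgebra.map_apply_ι _ _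
  rw [map_add, map_mul, contr_pullR, LinearEquiv.coe_coe, LinearEquiv.apply_symm_apply, h]

/-- Contracting `e^b ∧ α` produces the extra term `(i_X b) ∧ e^b ∧ α`, which is exactly what the
shift by `-i_X b` removes. -/
theorem exp_mul_actR [FiniteDimensional ℝ V] {b : RForm V} (hb : b ∈ ⋀[ℝ]^2 (Module.Dual ℝ V))
    (e : GT V) (α : RForm V) :
    IsNilpotent.exp b * actR e α = actR (bShift b e) (IsNilpotent.exp b * α) := by
  change IsNilpotent.exp b * (contr e.2 α + ExteriorAlgebra.ι ℝ e.1 * α) =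
    contr e.2 (IsNilpotent.exp b * α) +
      ExteriorAlgebra.ι ℝ (e.1 - bContract b e.2) * (IsNilpotent.exp b * α)
  rw [contr_exp_mul hb, map_sub, ι_bContract hb, sub_mul, mul_add, ← mul_assoc,
    (exp_commute hb (ExteriorAlgebra.ι ℝ e.1)).eq, mul_assoc]
  abel

variable [FiniteDimensional ℝ V]

theorem spinMapR_actR (A : V ≃ₗ[ℝ] W) {b : RForm V}
    (hb : b ∈ ⋀[ℝ]^2 (Module.Dual ℝ V)) (e : GT W) (α : RForm W) :
    spinMapR A.toLinearMap b (actR e α) = actR (gtMap A b e) (spinMapR A.toLinearMap b α) := by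
  rw [spinMapR_apply, pullR_actR, exp_mul_actR hb]
  rfl

theorem spinMap_act (A : V ≃ₗ[ℝ] W) {b : RForm V}
    (hb : b ∈ ⋀[ℝ]^2 (Module.Dual ℝ V)) (e : GTC W) (τ : CForm W) :
    spinMap A.toLinearMap b (act e τ) =
      act (LinearMap.baseChange ℂ (gtMap A b) e) (spinMap A.toLinearMap b τ) := by
  induction e using TensorProduct.induction_on with
  | zero => simp only [map_zero, LinearMap.zero_apply]
  | add x y hx hy => simp only [map_add, LinearMap.add_apply, hx, hy]
  | tmul z e =>
    induction τ using TensorProduct.induction_on with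
    | zero => simp only [map_zero]
    | add x y hx hy => simp only [map_add, hx, hy]
    | tmul w α =>
      rw [act_tmul_tmul, spinMap_tmul, spinMap_tmul, LinearMap.baseChange_tmul, act_tmul_tmul,
        spinMapR_actR A hb]

/-- Both sides are compatible with products in `N`, so the case of a single vector suffices. -/
theorem spinMapR_spinR (A : V ≃ₗ[ℝ] W) {b : RForm V}
    (hb : b ∈ ⋀[ℝ]^2 (Module.Dual ℝ V)) (N : CliffordAlgebra (QuadraticForm.dualProd ℝ W))
    (α : RForm W) :
    spinMapR A.toLinearMap b (spinR N α) =
      spinR (CliffordAlgebra.map (gtIsometry A hb) N) (spinMapR A.toLinearMap b α) := by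
  induction N using CliffordAlgebra.induction generalizing α with
  | algebraMap r => simp [Module.algebraMap_end_apply]
  | ι e =>
    rw [CliffordAlgebra.map_apply_ι, spinR, spinR, CliffordAlgebra.lift_ι_apply,
      CliffordAlgebra.lift_ι_apply]
    exact spinMapR_actR A hb e α
  | mul x y hx hy => rw [map_mul, map_mul, map_mul, Module.End.mul_apply, hx, hy]; rfl
  | add x y hx hy => simp only [map_add, LinearMap.add_apply, hx, hy]

theorem spinMap_spinC (A : V ≃ₗ[ℝ] W) {b : RForm V}
    (hb : b ∈ ⋀[ℝ]^2 (Module.Dual ℝ V)) (N : CliffordAlgebra (QuadraticForm.dualProd ℝ W))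
    (τ : CForm W) :
    spinMap A.toLinearMap b (spinC N τ) =
      spinC (CliffordAlgebra.map (gtIsometry A hb) N) (spinMap A.toLinearMap b τ) := by
  rw [spinMap, spinC, spinC, baseChange_baseChange, baseChange_baseChange]
  congr 2
  exact LinearMap.ext fun α => spinMapR_spinR A hb N α

theorem spinMapR_symm_spinMapR (A : V ≃ₗ[ℝ] W) {b : RForm V}
    (hb : b ∈ ⋀[ℝ]^2 (Module.Dual ℝ V)) (α : RForm W) :
    spinMapR A.symm.toLinearMap (-pullR A.symm.toLinearMap b) (spinMapR A.toLinearMap b α) = α := by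
  have : FiniteDimensional ℝ W := Module.Finite.equiv A
  rw [spinMapR_apply, spinMapR_apply, map_mul, pullR_exp _ hb, pullR_comp, LinearEquiv.comp_symm,
    pullR_id, ← mul_assoc,
    IsNilpotent.exp_neg_mul_exp_self (twoForm_isNilpotent (pullR_mem _ hb)), one_mul]

theorem spinMap_symm_spinMap (A : V ≃ₗ[ℝ] W) {b : RForm V}
    (hb : b ∈ ⋀[ℝ]^2 (Module.Dual ℝ V)) (τ : CForm W) :
    spinMap A.symm.toLinearMap (-pullR A.symm.toLinearMap b) (spinMap A.toLinearMap b τ) = τ := by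
  rw [spinMap, spinMap, baseChange_baseChange]
  convert baseChange_id_apply τ
  exact LinearMap.ext (spinMapR_symm_spinMapR A hb)

theorem spinMap_injective (A : V ≃ₗ[ℝ] W) {b : RForm V}
    (hb : b ∈ ⋀[ℝ]^2 (Module.Dual ℝ V)) : Function.Injective (spinMap A.toLinearMap b) :=
  Function.LeftInverse.injective (spinMap_symm_spinMap A hb)

/-- The factors `e^b` and `σ(e^b) = e^{-b}` commute with everything and cancel before the top
component is taken. Equality of the two dimensions ensures that both pairings use the same degree.
-/
theorem spinPairing_spinMap (A : V ≃ₗ[ℝ] W) {b : RForm V}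
    (hb : b ∈ ⋀[ℝ]^2 (Module.Dual ℝ V)) (σ τ : CForm W) :
    spinPairing (spinMap A.toLinearMap b σ) (spinMap A.toLinearMap b τ) =
      pullC A.toLinearMap (spinPairing σ τ) := by
  have key : spinMap A.toLinearMap b σ * sigma (spinMap A.toLinearMap b τ) =
      pullC A.toLinearMap (σ * sigma τ) := by
    induction σ using TensorProduct.induction_on with
    | zero => simp only [map_zero, zero_mul]
    | add x y hx hy => simp only [map_add, add_mul, hx, hy]
    | tmul z α =>
      induction τ using TensorProduct.induction_on with
      | zero => simp only [map_zero, mul_zero]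
      | add x y hx hy => simp only [map_add, mul_add, hx, hy]
      | tmul w β =>
        have hc := (exp_commute (neg_twoForm hb)
          (pullR A.toLinearMap (CliffordAlgebra.reverse (Q := 0) β))).eq
        have hc' := (exp_commute hb (pullR A.toLinearMap α)).eq
        simp only [sigma, spinMap_tmul, LinearMap.baseChange_tmul, pullC_tmul,
          Algebra.TensorProduct.tmul_mul_tmul, spinMapR_apply]
        congr 1
        rw [CliffordAlgebra.reverse.map_mul, reverse_pullR, reverse_exp hb, map_mul, ← hc, hc',
          mul_assoc, ← mul_assoc (IsNilpotent.exp b),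
          IsNilpotent.exp_mul_exp_neg_self (twoForm_isNilpotent hb), one_mul]
  have hcomp : ∀ (k : ℕ) (ρ : CForm W),
      comp k (pullC A.toLinearMap ρ) = pullC A.toLinearMap (comp k ρ) := by
    intro k ρ
    rw [comp, comp, pullC, baseChange_baseChange, baseChange_baseChange]
    congr 2
    exact LinearMap.ext (proj_pullR A.toLinearMap k)
  rw [spinPairing, spinPairing, key, hcomp, A.finrank_eq]

theorem parity_spinMap (A : V ≃ₗ[ℝ] W) {b : RForm V}
    (hb : b ∈ ⋀[ℝ]^2 (Module.Dual ℝ V)) (τ : CForm W) :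
    parity (spinMap A.toLinearMap b τ) = spinMap A.toLinearMap b (parity τ) := by
  rw [parity, parity, spinMap, baseChange_baseChange, baseChange_baseChange]
  congr 2
  refine LinearMap.ext fun α => ?_
  change CliffordAlgebra.involute (Q := 0) (IsNilpotent.exp b * pullR A.toLinearMap α) =
    IsNilpotent.exp b * pullR A.toLinearMap (CliffordAlgebra.involute (Q := 0) α)
  rw [← involute_pullR]
  nth_rw 2 [← involute_exp hb]
  exact map_mul _ _ _

/-- Since `spinMap` is injective and intertwines the actions, `e · τ` vanishes exactly when its
image does. -/
theorem mem_spinorKer_spinMap (A : V ≃ₗ[ℝ] W) {b : RForm V}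
    (hb : b ∈ ⋀[ℝ]^2 (Module.Dual ℝ V)) (τ : CForm W) (e : GTC W) :
    gtEquivC A hb e ∈ spinorKer (spinMap A.toLinearMap b τ) ↔ e ∈ spinorKer τ := by
  change act (LinearMap.baseChange ℂ (gtMap A b) e) (spinMap A.toLinearMap b τ) = 0 ↔ act e τ = 0
  rw [← spinMap_act A hb, map_eq_zero_iff _ (spinMap_injective A hb)]

theorem IsPure.spinMap (A : V ≃ₗ[ℝ] W) {b : RForm V}
    (hb : b ∈ ⋀[ℝ]^2 (Module.Dual ℝ V)) {τ : CForm W} (hτ : IsPure τ) :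
    IsPure (spinMap A.toLinearMap b τ) where
  ne_zero h := hτ.ne_zero ((map_eq_zero_iff _ (spinMap_injective A hb)).mp h)
  even_or_odd := by
    rw [parity_spinMap A hb]
    rcases hτ.even_or_odd with h | h
    · exact Or.inl (by rw [h])
    · exact Or.inr (by rw [h, map_neg])
  finrank_ker := by
    have h : spinorKer (GenKahler.spinMap A.toLinearMap b τ) =
        (spinorKer τ).map (gtEquivC A hb).toLinearMap := by
      ext e
      obtain ⟨e, rfl⟩ := (gtEquivC A hb).surjective e
      rw [mem_spinorKer_spinMap A hb]
      constructor
      · exact fun he => ⟨e, he, rfl⟩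
      · rintro ⟨f, hf, hfe⟩
        rwa [← (gtEquivC A hb).injective hfe]
    rw [h, A.finrank_eq, ← hτ.finrank_ker]
    exact LinearEquiv.finrank_map_eq (gtEquivC A hb) _

theorem IsNondegenerate.spinMap (A : V ≃ₗ[ℝ] W) {b : RForm V}
    (hb : b ∈ ⋀[ℝ]^2 (Module.Dual ℝ V)) {τ : CForm W} (hτ : IsNondegenerate τ) :
    IsNondegenerate (spinMap A.toLinearMap b τ) := by
  intro e he hec
  obtain ⟨e, rfl⟩ := (gtEquivC A hb).surjective e
  rw [gtEquivC_apply, conjC_baseChange, ← gtEquivC_apply A hb, mem_spinorKer_spinMap A hb] at hec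
  rw [hτ e ((mem_spinorKer_spinMap A hb τ e).mp he) hec, map_zero]

/-- The vector map is the complexification of a real map, so it commutes with conjugation and
carries both eigenspaces of `J` to those of its transport. -/
theorem Induces.spinMap (A : V ≃ₗ[ℝ] W) {b : RForm V}
    (hb : b ∈ ⋀[ℝ]^2 (Module.Dual ℝ V)) {τ : CForm W} {J : GT W →ₗ[ℝ] GT W} (hτ : Induces τ J) :
    Induces (spinMap A.toLinearMap b τ) (gtConj A b J) := by
  have hJ : ∀ e : GTC W, LinearMap.baseChange ℂ (gtConj A b J)
      (LinearMap.baseChange ℂ (gtMap A b) e) =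
        LinearMap.baseChange ℂ (gtMap A b) (LinearMap.baseChange ℂ J e) := by
    intro e
    rw [baseChange_baseChange, baseChange_baseChange]
    congr 2
    exact LinearMap.ext (gtConj_gtMap A hb J)
  intro e he
  obtain ⟨e, rfl⟩ := (gtEquivC A hb).surjective e
  obtain ⟨h1, h2⟩ := hτ e ((mem_spinorKer_spinMap A hb τ e).mp he)
  rw [gtEquivC_apply, conjC_baseChange, hJ, hJ, h1, h2, map_neg, map_smul, map_smul]
  exact ⟨rfl, rfl⟩

end Transport

/-! ### Calculus of coordinatewise smooth functions with values in vector spaces. -/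

section SmoothOn

variable {E : Type*} [NormedAddCommGroup E] [NormedSpace ℝ E]
variable {P Q S : Type*} [AddCommGroup P] [Module ℝ P] [AddCommGroup Q] [Module ℝ Q]
  [AddCommGroup S] [Module ℝ S] {s t : Set E} {f g : E → P}

theorem SmoothOn.mono (hf : SmoothOn f s) (h : t ⊆ s) : SmoothOn f t := fun l => (hf l).mono h

theorem SmoothOn.congr (hf : SmoothOn f s) (h : ∀ y ∈ s, g y = f y) : SmoothOn g s :=
  fun l => (hf l).congr fun y hy => by rw [h y hy]

theorem SmoothOn.of_locally (h : ∀ y ∈ s, ∃ t, IsOpen t ∧ y ∈ t ∧ SmoothOn f (s ∩ t)) :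
    SmoothOn f s := by
  refine fun l => contDiffOn_of_locally_contDiffOn fun y hy => ?_
  obtain ⟨t, ht, hyt, hf⟩ := h y hy
  exact ⟨t, ht, hyt, hf l⟩

theorem smoothOn_const (p : P) : SmoothOn (fun _ : E => p) s := fun _ => contDiffOn_const

theorem SmoothOn.add (hf : SmoothOn f s) (hg : SmoothOn g s) : SmoothOn (fun y => f y + g y) s :=
  fun l => ((hf l).add (hg l)).congr fun _ _ => map_add l _ _

theorem SmoothOn.sub (hf : SmoothOn f s) (hg : SmoothOn g s) : SmoothOn (fun y => f y - g y) s :=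
  fun l => ((hf l).sub (hg l)).congr fun _ _ => map_sub l _ _

theorem SmoothOn.linear (L : P →ₗ[ℝ] Q) (hf : SmoothOn f s) : SmoothOn (fun y => L (f y)) s :=
  fun l => hf (l ∘ₗ L)

theorem SmoothOn.prodMk {g : E → Q} (hf : SmoothOn f s) (hg : SmoothOn g s) :
    SmoothOn (fun y => (f y, g y)) s :=
  ((hf.linear (LinearMap.inl ℝ P Q)).add (hg.linear (LinearMap.inr ℝ P Q))).congr fun y _ => by
    simp

theorem SmoothOn.sum {ι : Type*} (u : Finset ι) {f : ι → E → P} (hf : ∀ i ∈ u, SmoothOn (f i) s) :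
    SmoothOn (fun y => ∑ i ∈ u, f i y) s := fun l =>
  (ContDiffOn.sum fun i hi => hf i hi l).congr fun _ _ => map_sum l _ _

theorem SmoothOn.smul {c : E → ℝ} (hc : ContDiffOn ℝ ∞ c s) (hf : SmoothOn f s) :
    SmoothOn (fun y => c y • f y) s :=
  fun l => (hc.mul (hf l)).congr fun y _ => by rw [map_smul, smul_eq_mul]

/-- Expanding the first argument in a finite basis reduces this to smooth scalars times linear
images of the second. It yields the smoothness of products, Clifford actions and base changes. -/
theorem SmoothOn.bilinear [Module.Finite ℝ P] (B : P →ₗ[ℝ] Q →ₗ[ℝ] S) {g : E → Q}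
    (hf : SmoothOn f s) (hg : SmoothOn g s) : SmoothOn (fun y => B (f y) (g y)) s := by
  let b := Module.finBasis ℝ P
  refine SmoothOn.congr (f := fun y => ∑ i, b.repr (f y) i • B (b i) (g y)) ?_ fun y _ => ?_
  · exact SmoothOn.sum _ fun i _ => SmoothOn.smul (hf (b.coord i)) (hg.linear (B (b i)))
  · conv_lhs => rw [← b.sum_repr (f y)]
    simp only [map_sum, map_smul, LinearMap.sum_apply, LinearMap.smul_apply]

theorem SmoothOn.comp {E' : Type*} [NormedAddCommGroup E'] [NormedSpace ℝ E'] {t : Set E'}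
    {h : E' → E} (hf : SmoothOn f s) (hh : ContDiffOn ℝ ∞ h t) (hst : Set.MapsTo h t s) :
    SmoothOn (fun y => f (h y)) t :=
  fun l => (hf l).comp hh hst

theorem ContDiffOn.smoothOn {G : Type*} [NormedAddCommGroup G] [NormedSpace ℝ G]
    [FiniteDimensional ℝ G] {f : E → G} (hf : ContDiffOn ℝ ∞ f s) : SmoothOn f s := fun l =>
  (LinearMap.toContinuousLinearMap l).contDiff.comp_contDiffOn hf

theorem SmoothOn.baseChange [Module.Finite ℝ P] [Module.Finite ℝ Q] {f : E → P →ₗ[ℝ] Q}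
    {t : E → ℂ ⊗[ℝ] P} (hf : SmoothOn f s) (ht : SmoothOn t s) :
    SmoothOn (fun y => LinearMap.baseChange ℂ (f y) (t y)) s :=
  SmoothOn.bilinear (LinearMap.lTensorHom (R := ℝ) ℂ) hf ht

section Forms

variable {V W : Type*} [AddCommGroup V] [Module ℝ V] [AddCommGroup W] [Module ℝ W]

theorem reC_ofR (α : RForm V) : reC _ (ofR α) = α := by simp [reC, ofR]

theorem SmoothOn.ofR {α : E → RForm V} (h : SmoothOn α s) : SmoothOn (fun y => ofR (α y)) s :=
  h.linear (TensorProduct.mk ℝ ℂ (RForm V) 1)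

theorem SmoothOn.of_ofR {α : E → RForm V} (h : SmoothOn (fun y => GenKahler.ofR (α y)) s) :
    SmoothOn α s :=
  (h.linear (reC (RForm V))).congr fun _ _ => (reC_ofR _).symm

/-- Contraction `X ↦ i_X b` as a linear function of `b`. -/
def bContractₗ : RForm V →ₗ[ℝ] V →ₗ[ℝ] Module.Dual ℝ V where
  toFun := bContract
  map_add' b c := by ext; simp [bContract]
  map_smul' r b := by ext; simp [bContract]

theorem SmoothOn.bShift {b : E → RForm V} (hb : SmoothOn b s) :
    SmoothOn (fun y => bShift (b y)) s := by
  let L : RForm V →ₗ[ℝ] (GT V →ₗ[ℝ] GT V) :=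
    LinearMap.compRight ℝ (LinearMap.inl ℝ (Module.Dual ℝ V) V) ∘ₗ
      LinearMap.lcomp ℝ (Module.Dual ℝ V) (LinearMap.snd ℝ (Module.Dual ℝ V) V) ∘ₗ bContractₗ
  refine ((smoothOn_const LinearMap.id).sub (hb.linear L)).congr fun y _ => ?_
  refine LinearMap.ext fun e => Prod.ext rfl ?_
  simp [L, GenKahler.bShift]

/-- `gtPull` as a linear function of the pair of maps. -/
def gtPullₗ : ((V →ₗ[ℝ] W) × (W →ₗ[ℝ] V)) →ₗ[ℝ] (GT W →ₗ[ℝ] GT V) where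
  toFun p := gtPull p.1 p.2
  map_add' _ _ := LinearMap.ext fun _ => Prod.ext (LinearMap.ext fun _ => by simp [gtPull])
    (by simp [gtPull])
  map_smul' _ _ := LinearMap.ext fun _ => Prod.ext (LinearMap.ext fun _ => by simp [gtPull])
    (by simp [gtPull])

/-- Linear in the pair, with the two maps treated as independent; smoothness of the inverse
derivative is a separate matter, settled in `smoothOn_inverse_fderiv_transition`. -/
theorem SmoothOn.gtPull {A : E → V →ₗ[ℝ] W} {B : E → W →ₗ[ℝ] V} (hA : SmoothOn A s)
    (hB : SmoothOn B s) : SmoothOn (fun y => gtPull (A y) (B y)) s :=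
  SmoothOn.linear (Q := GT W →ₗ[ℝ] GT V) gtPullₗ (hA.prodMk hB)

variable [FiniteDimensional ℝ V]

theorem SmoothOn.mulR {σ τ : E → RForm V} (hσ : SmoothOn σ s) (hτ : SmoothOn τ s) :
    SmoothOn (fun y => σ y * τ y) s := SmoothOn.bilinear (LinearMap.mul ℝ (RForm V)) hσ hτ

theorem SmoothOn.mulC {σ τ : E → CForm V} (hσ : SmoothOn σ s) (hτ : SmoothOn τ s) :
    SmoothOn (fun y => σ y * τ y) s := SmoothOn.bilinear (LinearMap.mul ℝ (CForm V)) hσ hτ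

theorem SmoothOn.act {e : E → GTC V} {τ : E → CForm V} (he : SmoothOn e s) (hτ : SmoothOn τ s) :
    SmoothOn (fun y => act (e y) (τ y)) s :=
  SmoothOn.bilinear ((GenKahler.act (V := V)).restrictScalars₁₂ ℝ ℝ) he hτ

/-- Pullback is not linear in `A`, but on a fixed form it is polynomial in `A`, which an induction
over the exterior algebra exploits. -/
theorem SmoothOn.pullR_const {A : E → V →ₗ[ℝ] W} (hA : SmoothOn A s) (α : RForm W) :
    SmoothOn (fun y => pullR (A y) α) s := by
  induction α using ExteriorAlgebra.induction with
  | algebraMap r =>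
    exact (smoothOn_const (algebraMap ℝ (RForm V) r)).congr fun y _ => AlgHom.commutes _ _
  | ι u =>
    refine (hA.linear (ExteriorAlgebra.ι ℝ ∘ₗ LinearMap.applyₗ u ∘ₗ
      Module.Dual.transpose (R := ℝ) (M := V) (M' := W))).congr fun y _ => ?_
    exact ExteriorAlgebra.map_apply_ι _ _
  | mul a c ha hc => exact (ha.mulR hc).congr fun y _ => map_mul _ _ _
  | add a c ha hc => exact (ha.add hc).congr fun y _ => map_add _ _ _

theorem SmoothOn.pullC_const {A : E → V →ₗ[ℝ] W} (hA : SmoothOn A s) (τ : CForm W) :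
    SmoothOn (fun y => pullC (A y) τ) s := by
  induction τ using TensorProduct.induction_on with
  | zero => exact (smoothOn_const 0).congr fun y _ => map_zero _
  | tmul z α => exact (hA.pullR_const α).linear (TensorProduct.mk ℝ ℂ (RForm V) z)
  | add a c ha hc => exact (ha.add hc).congr fun y _ => map_add _ _ _

theorem SmoothOn.pullC [FiniteDimensional ℝ W] {A : E → V →ₗ[ℝ] W} (hA : SmoothOn A s)
    {τ : E → CForm W} (hτ : SmoothOn τ s) : SmoothOn (fun y => pullC (A y) (τ y)) s := by
  let b := Module.finBasis ℝ (CForm W)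
  refine SmoothOn.congr (f := fun y => ∑ i, b.repr (τ y) i • GenKahler.pullC (A y) (b i)) ?_
    fun y _ => ?_
  · exact SmoothOn.sum _ fun i _ => SmoothOn.smul (hτ (b.coord i)) (hA.pullC_const (b i))
  · conv_lhs => rw [← b.sum_repr (τ y)]
    rw [map_sum]
    exact Finset.sum_congr rfl fun i _ => LinearMap.map_smul_of_tower _ _ _

theorem SmoothOn.pow {α : E → RForm V} (h : SmoothOn α s) (k : ℕ) :
    SmoothOn (fun y => α y ^ k) s := by
  induction k with
  | zero => exact (smoothOn_const 1).congr fun y _ => pow_zero _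
  | succ k ih => exact (ih.mulR h).congr fun y _ => pow_succ _ _

theorem SmoothOn.exp {b : E → RForm V} (h : SmoothOn b s)
    (hb : ∀ y ∈ s, b y ∈ ⋀[ℝ]^2 (Module.Dual ℝ V)) :
    SmoothOn (fun y => IsNilpotent.exp (b y)) s := by
  have hs : SmoothOn (fun y => ∑ i ∈ Finset.range (Module.finrank ℝ (Module.Dual ℝ V) + 1),
      (((i.factorial : ℚ)⁻¹ : ℚ) : ℝ) • b y ^ i) s :=
    SmoothOn.sum _ fun i _ => SmoothOn.smul contDiffOn_const (h.pow i)
  refine hs.congr fun y hy => ?_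
  rw [IsNilpotent.exp_eq_sum (twoForm_pow_eq_zero (hb y hy))]
  exact Finset.sum_congr rfl fun i _ => (Rat.cast_smul_eq_qsmul ℝ _ _).symm

end Forms

end SmoothOn

/-! ### Composition rules, used to pass between tangent spaces and charts. -/

section Composition

variable {V W Z : Type*} [AddCommGroup V] [Module ℝ V] [AddCommGroup W] [Module ℝ W]
  [AddCommGroup Z] [Module ℝ Z]

theorem pullC_spinMap [FiniteDimensional ℝ W] (B : V →ₗ[ℝ] W) (A : W →ₗ[ℝ] Z) {b : RForm W}
    (hb : b ∈ ⋀[ℝ]^2 (Module.Dual ℝ W)) (τ : CForm Z) :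
    pullC B (spinMap A b τ) = spinMap (A ∘ₗ B) (pullR B b) τ := by
  rw [spinMap_eq, spinMap_eq, pullC_mul, pullC_ofR, pullR_exp B hb, pullC_comp]

theorem spinMap_pullC (B : V →ₗ[ℝ] W) (b : RForm V) (A : W →ₗ[ℝ] Z) (τ : CForm Z) :
    spinMap B b (pullC A τ) = spinMap (A ∘ₗ B) b τ := by
  rw [spinMap_eq, spinMap_eq, pullC_comp]

theorem gtPull_gtMap (B : V ≃ₗ[ℝ] W) (A : W ≃ₗ[ℝ] Z) {b : RForm W}
    (hb : b ∈ ⋀[ℝ]^2 (Module.Dual ℝ W)) :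
    gtPull B.toLinearMap B.symm.toLinearMap ∘ₗ gtMap A b =
      gtMap (B.trans A) (pullR B.toLinearMap b) := by
  refine LinearMap.ext fun e => Prod.ext (LinearMap.ext fun X => ?_) rfl
  simp [gtMap_apply, gtPull, bContract_pullR _ hb]

theorem gtMap_gtPull (B : V ≃ₗ[ℝ] W) (A : W ≃ₗ[ℝ] Z) (b : RForm V) :
    gtMap B b ∘ₗ gtPull A.toLinearMap A.symm.toLinearMap = gtMap (B.trans A) b := rfl

end Composition

/-! ### Charts and the coordinate expression of a diffeomorphism. -/

section Charts

variable {n : ℕ} {M : Type*} [TopologicalSpace M] [ChartedSpace (EuclideanSpace ℝ (Fin (2 * n))) M]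

instance (x : M) : FiniteDimensional ℝ (T n x) :=
  inferInstanceAs (FiniteDimensional ℝ (EuclideanSpace ℝ (Fin (2 * n))))

theorem isOpen_chartDomain (p : M) {U : Set M} (hU : IsOpen U) : IsOpen (chartDomain n p U) :=
  (continuousOn_extChartAt_symm p).isOpen_inter_preimage (isOpen_extChartAt_target p) hU

/-- A diffeomorphism has no single target chart over a whole source chart; this allows the target
chart to vary with the point. -/
theorem smoothOn_chartDomain_of_locally {P : Type*} [AddCommGroup P] [Module ℝ P] {p : M}
    {f : EuclideanSpace ℝ (Fin (2 * n)) → P} {U : Set M}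
    (h : ∀ y ∈ chartDomain n p U, ∃ S : Set M, IsOpen S ∧ (extChartAt (𝓡 (2 * n)) p).symm y ∈ S ∧
      SmoothOn f (chartDomain n p (U ∩ S))) : SmoothOn f (chartDomain n p U) := by
  refine SmoothOn.of_locally fun y hy => ?_
  obtain ⟨S, hS, hyS, hf⟩ := h y hy
  exact ⟨chartDomain n p S, isOpen_chartDomain p hS, ⟨hy.1, hyS⟩,
    hf.mono fun z hz => ⟨hz.1.1, hz.1.2, hz.2.2⟩⟩

/-- The derivative of a diffeomorphism as a linear equivalence. -/
def dF (F : M ≃ₘ⟮𝓡 (2 * n), 𝓡 (2 * n)⟯ M) (x : M) : T n x ≃ₗ[ℝ] T n (F x) :=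
  (F.mfderivToContinuousLinearEquiv (by simp) x).toLinearEquiv

theorem dF_toLinearMap (F : M ≃ₘ⟮𝓡 (2 * n), 𝓡 (2 * n)⟯ M) (x : M) :
    (dF F x).toLinearMap = (mfderiv (𝓡 (2 * n)) (𝓡 (2 * n)) F x).toLinearMap :=
  congrArg ContinuousLinearMap.toLinearMap (F.mfderivToContinuousLinearEquiv_coe (by simp))

theorem smul_apply (g : ExtDiffeo n M) (τ : CField n M) (x : M) :
    g.smul τ x = spinMap (dF g.F x).toLinearMap (g.b x) (τ (g.F x)) := by
  rw [spinMap_eq, dF_toLinearMap]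
  rfl

/-- The action of `g = e^b F` on sections of `(T ⊕ T^*)^ℂ`. -/
def gtSmul (g : ExtDiffeo n M) (e : GTField n M) : GTField n M := fun x =>
  LinearMap.baseChange ℂ (gtMap (dF g.F x) (g.b x)) (e (g.F x))

/-- A diffeomorphism in charts. -/
def transition (F : M ≃ₘ⟮𝓡 (2 * n), 𝓡 (2 * n)⟯ M) (p q : M) (y : EuclideanSpace ℝ (Fin (2 * n))) :
    EuclideanSpace ℝ (Fin (2 * n)) :=
  extChartAt (𝓡 (2 * n)) q (F ((extChartAt (𝓡 (2 * n)) p).symm y))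

/-- The part of the chart around `p` that `F` maps into the chart around `q`. -/
def transitionDomain (F : M ≃ₘ⟮𝓡 (2 * n), 𝓡 (2 * n)⟯ M) (p q : M) :
    Set (EuclideanSpace ℝ (Fin (2 * n))) :=
  chartDomain n p (F ⁻¹' (extChartAt (𝓡 (2 * n)) q).source)

theorem isOpen_transitionDomain (F : M ≃ₘ⟮𝓡 (2 * n), 𝓡 (2 * n)⟯ M) (p q : M) :
    IsOpen (transitionDomain F p q) :=
  isOpen_chartDomain p ((isOpen_extChartAt_source q).preimage F.continuous)

variable [IsManifold (𝓡 (2 * n)) ∞ M]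

theorem isManifold_one : IsManifold (𝓡 (2 * n)) 1 M :=
  IsManifold.of_le (n := ∞) (by norm_cast)

theorem dChart_comp_dChartInv {p : M} {y : EuclideanSpace ℝ (Fin (2 * n))}
    (hy : y ∈ (extChartAt (𝓡 (2 * n)) p).target) :
    dChart n p ((extChartAt (𝓡 (2 * n)) p).symm y) ∘ₗ dChartInv p y = LinearMap.id := by
  have := isManifold_one (n := n) (M := M)
  have h := mfderiv_extChartAt_comp_mfderivWithin_extChartAt_symm (I := 𝓡 (2 * n)) hy
  rw [ModelWithCorners.Boundaryless.range_eq_univ, mfderivWithin_univ] at h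
  exact congrArg ContinuousLinearMap.toLinearMap h

theorem dChartInv_comp_dChart {p : M} {y : EuclideanSpace ℝ (Fin (2 * n))}
    (hy : y ∈ (extChartAt (𝓡 (2 * n)) p).target) :
    dChartInv p y ∘ₗ dChart n p ((extChartAt (𝓡 (2 * n)) p).symm y) = LinearMap.id := by
  have := isManifold_one (n := n) (M := M)
  have h := mfderivWithin_extChartAt_symm_comp_mfderiv_extChartAt (I := 𝓡 (2 * n)) hy
  rw [ModelWithCorners.Boundaryless.range_eq_univ, mfderivWithin_univ] at h
  exact congrArg ContinuousLinearMap.toLinearMap h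

theorem dChart_bijective {p x : M} (hx : x ∈ (extChartAt (𝓡 (2 * n)) p).source) :
    Function.Bijective (dChart n p x) := by
  obtain ⟨y, hy, rfl⟩ : ∃ y ∈ (extChartAt (𝓡 (2 * n)) p).target,
      (extChartAt (𝓡 (2 * n)) p).symm y = x :=
    ⟨_, (extChartAt (𝓡 (2 * n)) p).map_source hx, (extChartAt (𝓡 (2 * n)) p).left_inv hx⟩
  exact Function.bijective_iff_has_inverse.mpr ⟨dChartInv p y,
    LinearMap.congr_fun (dChartInv_comp_dChart hy), LinearMap.congr_fun (dChart_comp_dChartInv hy)⟩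

/-- The derivative of a chart as a linear equivalence. -/
def chartEquiv {p x : M} (hx : x ∈ (extChartAt (𝓡 (2 * n)) p).source) :
    T n x ≃ₗ[ℝ] EuclideanSpace ℝ (Fin (2 * n)) :=
  LinearEquiv.ofBijective (dChart n p x) (dChart_bijective hx)

theorem chartEquiv_toLinearMap {p x : M} (hx : x ∈ (extChartAt (𝓡 (2 * n)) p).source) :
    (chartEquiv hx).toLinearMap = dChart n p x := rfl

theorem chartEquiv_symm_toLinearMap {p : M} {y : EuclideanSpace ℝ (Fin (2 * n))}
    (hy : y ∈ (extChartAt (𝓡 (2 * n)) p).target) :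
    (chartEquiv ((extChartAt (𝓡 (2 * n)) p).map_target hy)).symm.toLinearMap = dChartInv p y := by
  refine LinearMap.ext fun v => ?_
  rw [LinearEquiv.coe_coe, LinearEquiv.symm_apply_eq]
  exact (LinearMap.congr_fun (dChart_comp_dChartInv hy) v).symm

theorem inChart_extChartAt (τ : CField n M) {q z : M}
    (hz : z ∈ (extChartAt (𝓡 (2 * n)) q).source) :
    inChart τ q (extChartAt (𝓡 (2 * n)) q z) = pullC (chartEquiv hz).symm.toLinearMap (τ z) := by
  -- Chart and inverse chart return `z` only up to a propositional equality, and the fibres depend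
  -- on the point; generalizing the point lets the equality be substituted.
  have key : ∀ w (hw : w ∈ (extChartAt (𝓡 (2 * n)) q).source), w = z →
      pullC (chartEquiv hw).symm.toLinearMap (τ w) =
        pullC (chartEquiv hz).symm.toLinearMap (τ z) := by
    rintro _ _ rfl; rfl
  rw [← key _ (by rwa [(extChartAt (𝓡 (2 * n)) q).left_inv hz])
      ((extChartAt (𝓡 (2 * n)) q).left_inv hz),
    inChart, chartEquiv_symm_toLinearMap ((extChartAt (𝓡 (2 * n)) q).map_source hz)]

theorem gtInChart_extChartAt (e : GTField n M) {q z : M}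
    (hz : z ∈ (extChartAt (𝓡 (2 * n)) q).source) :
    gtInChart e q (extChartAt (𝓡 (2 * n)) q z) = LinearMap.baseChange ℂ
      (gtPull (chartEquiv hz).symm.toLinearMap (chartEquiv hz).toLinearMap) (e z) := by
  have key : ∀ w (hw : w ∈ (extChartAt (𝓡 (2 * n)) q).source), w = z →
      LinearMap.baseChange ℂ
        (gtPull (chartEquiv hw).symm.toLinearMap (chartEquiv hw).toLinearMap) (e w) =
      LinearMap.baseChange ℂ
        (gtPull (chartEquiv hz).symm.toLinearMap (chartEquiv hz).toLinearMap) (e z) := by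
    rintro _ _ rfl; rfl
  rw [← key _ (by rwa [(extChartAt (𝓡 (2 * n)) q).left_inv hz])
      ((extChartAt (𝓡 (2 * n)) q).left_inv hz),
    gtInChart, chartEquiv_symm_toLinearMap ((extChartAt (𝓡 (2 * n)) q).map_source hz)]
  rfl

theorem contDiffOn_transition (F : M ≃ₘ⟮𝓡 (2 * n), 𝓡 (2 * n)⟯ M) (p q : M) :
    ContDiffOn ℝ ∞ (transition F p q) (transitionDomain F p q) := by
  rw [← contMDiffOn_iff_contDiffOn]
  have h1 : ContMDiffOn 𝓘(ℝ, EuclideanSpace ℝ (Fin (2 * n))) (𝓡 (2 * n)) ∞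
      (fun y => F ((extChartAt (𝓡 (2 * n)) p).symm y)) (transitionDomain F p q) :=
    F.contMDiff.comp_contMDiffOn
      ((contMDiffOn_extChartAt_symm p).mono fun y hy => hy.1)
  refine (contMDiffOn_extChartAt (x := q)).comp h1 fun y hy => ?_
  have := hy.2
  rwa [Set.mem_preimage, Set.mem_preimage, extChartAt_source] at this

/-- The derivative of a diffeomorphism in charts. -/
def dTransition (F : M ≃ₘ⟮𝓡 (2 * n), 𝓡 (2 * n)⟯ M) {p q : M}
    {y : EuclideanSpace ℝ (Fin (2 * n))} (hy : y ∈ transitionDomain F p q) :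
    EuclideanSpace ℝ (Fin (2 * n)) ≃ₗ[ℝ] EuclideanSpace ℝ (Fin (2 * n)) :=
  ((chartEquiv ((extChartAt (𝓡 (2 * n)) p).map_target hy.1)).symm.trans
    (dF F ((extChartAt (𝓡 (2 * n)) p).symm y))).trans (chartEquiv hy.2)

/-- The chain rule. It identifies an equivalence defined point by point with a Fréchet derivative,
whose dependence on the point is smooth. -/
theorem dTransition_toLinearMap (F : M ≃ₘ⟮𝓡 (2 * n), 𝓡 (2 * n)⟯ M) {p q : M}
    {y : EuclideanSpace ℝ (Fin (2 * n))} (hy : y ∈ transitionDomain F p q) :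
    (dTransition F hy).toLinearMap = (fderiv ℝ (transition F p q) y).toLinearMap := by
  have hM := isManifold_one (n := n) (M := M)
  have h1 : MDifferentiableAt 𝓘(ℝ, EuclideanSpace ℝ (Fin (2 * n))) (𝓡 (2 * n))
      (extChartAt (𝓡 (2 * n)) p).symm y := by
    have := mdifferentiableWithinAt_extChartAt_symm (I := 𝓡 (2 * n)) hy.1
    rwa [ModelWithCorners.Boundaryless.range_eq_univ, mdifferentiableWithinAt_univ] at this
  have h2 : MDifferentiableAt (𝓡 (2 * n)) (𝓡 (2 * n)) F ((extChartAt (𝓡 (2 * n)) p).symm y) :=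
    F.mdifferentiable (by simp) _
  have h3 : MDifferentiableAt (𝓡 (2 * n)) 𝓘(ℝ, EuclideanSpace ℝ (Fin (2 * n)))
      (extChartAt (𝓡 (2 * n)) q) ((F ∘ (extChartAt (𝓡 (2 * n)) p).symm) y) := by
    refine mdifferentiableAt_extChartAt ?_
    have := hy.2
    rwa [Set.mem_preimage, Set.mem_preimage, extChartAt_source] at this
  have h : fderiv ℝ (transition F p q) y = _ :=
    (mfderiv_eq_fderiv (f := transition F p q) (x := y)).symm.trans
      ((mfderiv_comp y h3 (h2.comp y h1)).trans
        (congrArg _ (mfderiv_comp y h2 h1)))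
  rw [h, dTransition, LinearEquiv.coe_trans, LinearEquiv.coe_trans,
    chartEquiv_symm_toLinearMap hy.1, dF_toLinearMap]
  rfl

end Charts

/-! ### Smoothness of the transported forms and sections. -/

section Smoothness

variable {n : ℕ} {M : Type*} [TopologicalSpace M] [ChartedSpace (EuclideanSpace ℝ (Fin (2 * n))) M]

theorem FormSmoothOn.conjF {U : Set M} {τ : CField n M} (h : FormSmoothOn U τ) :
    FormSmoothOn U (conjF τ) := fun p =>
  ((h p).linear (conjC _)).congr fun _ _ => (conjC_baseChange _ _).symm

/-- The `2`-form of `g`, written in the chart around `p`. -/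
def bInChart (g : ExtDiffeo n M) (p : M) (y : EuclideanSpace ℝ (Fin (2 * n))) :
    RForm (EuclideanSpace ℝ (Fin (2 * n))) :=
  pullR (dChartInv p y) (g.b ((extChartAt (𝓡 (2 * n)) p).symm y))

theorem bInChart_mem (g : ExtDiffeo n M) (p : M) (y : EuclideanSpace ℝ (Fin (2 * n))) :
    bInChart g p y ∈ ⋀[ℝ]^2 (Module.Dual ℝ (EuclideanSpace ℝ (Fin (2 * n)))) :=
  pullR_mem _ (g.isForm.degree _)

theorem smoothOn_bInChart (g : ExtDiffeo n M) (p : M) (U : Set M) :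
    SmoothOn (bInChart g p) (chartDomain n p U) :=
  SmoothOn.of_ofR ((g.isForm.smooth p).mono fun _ hy => ⟨hy.1, trivial⟩)

variable [IsManifold (𝓡 (2 * n)) ∞ M]

theorem smoothOn_fderiv_transition (F : M ≃ₘ⟮𝓡 (2 * n), 𝓡 (2 * n)⟯ M) (p q : M) :
    SmoothOn (fun y => (fderiv ℝ (transition F p q) y).toLinearMap) (transitionDomain F p q) :=
  SmoothOn.linear (ContinuousLinearMap.coeLM ℝ) (ContDiffOn.smoothOn
    ((contDiffOn_transition F p q).fderiv_of_isOpen (isOpen_transitionDomain F p q)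
      (by norm_cast)))

/-- Inversion of continuous linear maps is smooth at every invertible map, and the derivative of a
diffeomorphism in charts is invertible. -/
theorem smoothOn_inverse_fderiv_transition (F : M ≃ₘ⟮𝓡 (2 * n), 𝓡 (2 * n)⟯ M) (p q : M) :
    SmoothOn (fun y => (fderiv ℝ (transition F p q) y).inverse.toLinearMap)
      (transitionDomain F p q) := by
  suffices hc : ContDiffOn ℝ ∞ (fun y => (fderiv ℝ (transition F p q) y).inverse)
      (transitionDomain F p q) from
    SmoothOn.linear (ContinuousLinearMap.coeLM ℝ) (ContDiffOn.smoothOn hc)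
  intro y hy
  have h := (contDiffOn_transition F p q).fderiv_of_isOpen (m := ∞) (isOpen_transitionDomain F p q)
    (by norm_cast) y hy
  have he : fderiv ℝ (transition F p q) y = (dTransition F hy).toContinuousLinearEquiv :=
    ContinuousLinearMap.coe_injective (dTransition_toLinearMap F hy).symm
  have hi : ContDiffAt ℝ ∞ ContinuousLinearMap.inverse (fderiv ℝ (transition F p q) y) := by
    rw [he]
    exact contDiffAt_map_inverse _
  exact hi.comp_contDiffWithinAt y h

theorem inverse_fderiv_transition (F : M ≃ₘ⟮𝓡 (2 * n), 𝓡 (2 * n)⟯ M) {p q : M}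
    {y : EuclideanSpace ℝ (Fin (2 * n))} (hy : y ∈ transitionDomain F p q) :
    (fderiv ℝ (transition F p q) y).inverse.toLinearMap = (dTransition F hy).symm.toLinearMap := by
  have he : fderiv ℝ (transition F p q) y = (dTransition F hy).toContinuousLinearEquiv :=
    ContinuousLinearMap.coe_injective (dTransition_toLinearMap F hy).symm
  rw [he, ContinuousLinearMap.inverse_equiv]
  rfl

theorem inChart_smul (g : ExtDiffeo n M) (τ : CField n M) {p q : M}
    {y : EuclideanSpace ℝ (Fin (2 * n))} (hy : y ∈ transitionDomain g.F p q) :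
    inChart (g.smul τ) p y = spinMap (dTransition g.F hy).toLinearMap (bInChart g p y)
      (inChart τ q (transition g.F p q y)) := by
  rw [transition, inChart_extChartAt τ hy.2, spinMap_pullC, inChart, smul_apply,
    pullC_spinMap _ _ (g.isForm.degree _), bInChart, ← chartEquiv_symm_toLinearMap hy.1]
  congr 1
  refine congrArg (spinMap · _) (LinearMap.ext fun v => ?_)
  exact ((chartEquiv hy.2).symm_apply_apply _).symm

theorem gtInChart_gtSmul (g : ExtDiffeo n M) (e : GTField n M) {p q : M}
    {y : EuclideanSpace ℝ (Fin (2 * n))} (hy : y ∈ transitionDomain g.F p q) :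
    gtInChart (gtSmul g e) p y = LinearMap.baseChange ℂ
      (gtMap (dTransition g.F hy) (bInChart g p y)) (gtInChart e q (transition g.F p q y)) := by
  rw [transition, gtInChart_extChartAt e hy.2, baseChange_baseChange, gtInChart, gtSmul,
    baseChange_baseChange, bInChart, ← chartEquiv_symm_toLinearMap hy.1]
  have h1 := gtPull_gtMap (chartEquiv ((extChartAt (𝓡 (2 * n)) p).map_target hy.1)).symm
    (dF g.F ((extChartAt (𝓡 (2 * n)) p).symm y)) (g.isForm.degree _)
  have h2 := gtMap_gtPull (dTransition g.F hy) (chartEquiv hy.2).symm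
    (pullR (chartEquiv ((extChartAt (𝓡 (2 * n)) p).map_target hy.1)).symm.toLinearMap
      (g.b ((extChartAt (𝓡 (2 * n)) p).symm y)))
  rw [LinearEquiv.symm_symm] at h1 h2
  rw [chartEquiv_toLinearMap] at h1
  rw [h1, h2]
  congr 3
  exact LinearEquiv.ext fun v => ((chartEquiv hy.2).symm_apply_apply _).symm

theorem FormSmoothOn.smul (g : ExtDiffeo n M) {U : Set M} {τ : CField n M}
    (h : FormSmoothOn U τ) : FormSmoothOn (g.F ⁻¹' U) (g.smul τ) := by
  intro p
  refine smoothOn_chartDomain_of_locally fun y hy => ?_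
  -- The target chart is centred at the image of the point, and only the part of the domain that `F`
  -- sends into it is considered.
  set q := g.F ((extChartAt (𝓡 (2 * n)) p).symm y)
  refine ⟨g.F ⁻¹' (extChartAt (𝓡 (2 * n)) q).source,
    (isOpen_extChartAt_source q).preimage g.F.continuous, mem_extChartAt_source q, ?_⟩
  have hD : chartDomain n p (g.F ⁻¹' U ∩ g.F ⁻¹' (extChartAt (𝓡 (2 * n)) q).source) ⊆
      transitionDomain g.F p q := fun z hz => ⟨hz.1, hz.2.2⟩
  have hmaps : Set.MapsTo (transition g.F p q)
      (chartDomain n p (g.F ⁻¹' U ∩ g.F ⁻¹' (extChartAt (𝓡 (2 * n)) q).source))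
      (chartDomain n q U) := by
    intro z hz
    refine ⟨(extChartAt (𝓡 (2 * n)) q).map_source hz.2.2, ?_⟩
    rw [Set.mem_preimage, transition, (extChartAt (𝓡 (2 * n)) q).left_inv hz.2.2]
    exact hz.2.1
  have hτ := (h q).comp ((contDiffOn_transition g.F p q).mono hD) hmaps
  have hb := (smoothOn_bInChart g p
    (g.F ⁻¹' U ∩ g.F ⁻¹' (extChartAt (𝓡 (2 * n)) q).source)).exp fun z _ => bInChart_mem g p z
  refine (hb.ofR.mulC (((smoothOn_fderiv_transition g.F p q).mono hD).pullC hτ)).congr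
    fun z hz => ?_
  rw [inChart_smul g τ (hD hz), spinMap_eq, dTransition_toLinearMap]

theorem GTSmoothOn.gtSmul (g : ExtDiffeo n M) {U : Set M} {e : GTField n M}
    (h : GTSmoothOn U e) : GTSmoothOn (g.F ⁻¹' U) (gtSmul g e) := by
  intro p
  refine smoothOn_chartDomain_of_locally fun y hy => ?_
  set q := g.F ((extChartAt (𝓡 (2 * n)) p).symm y)
  refine ⟨g.F ⁻¹' (extChartAt (𝓡 (2 * n)) q).source,
    (isOpen_extChartAt_source q).preimage g.F.continuous, mem_extChartAt_source q, ?_⟩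
  have hD : chartDomain n p (g.F ⁻¹' U ∩ g.F ⁻¹' (extChartAt (𝓡 (2 * n)) q).source) ⊆
      transitionDomain g.F p q := fun z hz => ⟨hz.1, hz.2.2⟩
  have hmaps : Set.MapsTo (transition g.F p q)
      (chartDomain n p (g.F ⁻¹' U ∩ g.F ⁻¹' (extChartAt (𝓡 (2 * n)) q).source))
      (chartDomain n q U) := by
    intro z hz
    refine ⟨(extChartAt (𝓡 (2 * n)) q).map_source hz.2.2, ?_⟩
    rw [Set.mem_preimage, transition, (extChartAt (𝓡 (2 * n)) q).left_inv hz.2.2]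
    exact hz.2.1
  have he := (h q).comp ((contDiffOn_transition g.F p q).mono hD) hmaps
  have hb := (smoothOn_bInChart g p
    (g.F ⁻¹' U ∩ g.F ⁻¹' (extChartAt (𝓡 (2 * n)) q).source)).bShift
  have hA := ((smoothOn_fderiv_transition g.F p q).mono hD).gtPull
    ((smoothOn_inverse_fderiv_transition g.F p q).mono hD)
  refine (hb.baseChange (hA.baseChange he)).congr fun z hz => ?_
  rw [gtInChart_gtSmul g e (hD hz), baseChange_baseChange, inverse_fderiv_transition g.F (hD hz),
    ← dTransition_toLinearMap g.F (hD hz)]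
  rfl

theorem inChart_actF (e : GTField n M) (τ : CField n M) {p : M}
    {y : EuclideanSpace ℝ (Fin (2 * n))} (hy : y ∈ (extChartAt (𝓡 (2 * n)) p).target) :
    inChart (actF e τ) p y = act (gtInChart e p y) (inChart τ p y) := by
  have key : ∀ {V W : Type} [AddCommGroup V] [Module ℝ V] [AddCommGroup W] [Module ℝ W]
      (A : V ≃ₗ[ℝ] W) (e : GTC W) (τ : CForm W), pullC A.toLinearMap (act e τ) =
      act (LinearMap.baseChange ℂ (gtPull A.toLinearMap A.symm.toLinearMap) e)
        (pullC A.toLinearMap τ) := by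
    intro V W _ _ _ _ A e τ
    induction e using TensorProduct.induction_on with
    | zero => simp only [map_zero, LinearMap.zero_apply]
    | add x y hx hy => simp only [map_add, LinearMap.add_apply, hx, hy]
    | tmul z e =>
      induction τ using TensorProduct.induction_on with
      | zero => simp only [map_zero]
      | add x y hx hy => simp only [map_add, hx, hy]
      | tmul w α =>
        rw [act_tmul_tmul, pullC_tmul, pullC_tmul, LinearMap.baseChange_tmul, act_tmul_tmul,
          pullR_actR]
  rw [inChart, gtInChart, inChart, ← chartEquiv_symm_toLinearMap hy, actF, key]
  rfl

theorem FormSmoothOn.actF {U : Set M} {e : GTField n M} {τ : CField n M} (he : GTSmoothOn U e)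
    (hτ : FormSmoothOn U τ) : FormSmoothOn U (actF e τ) := fun p =>
  ((he p).act (hτ p)).congr fun _ hy => inChart_actF e τ hy.1

end Smoothness

/-! ### Locality of `d_H` and extension of local forms. -/

section Locality

variable {n : ℕ} {M : Type*} [TopologicalSpace M] [ChartedSpace (EuclideanSpace ℝ (Fin (2 * n))) M]

/-- Only the value and the first derivative of the chart expression at the point enter, and both are
determined by the germ. -/
theorem dTw_congr (H : RField n M) {σ τ : CField n M} {x : M}
    (h : ∀ᶠ z in nhds x, σ z = τ z) : dTw H σ x = dTw H τ x := by
  have hx : (extChartAt (𝓡 (2 * n)) x).symm (extChartAt (𝓡 (2 * n)) x x) = x :=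
    extChartAt_to_inv x
  have hy : ∀ᶠ y in nhds (extChartAt (𝓡 (2 * n)) x x), inChart σ x y = inChart τ x y := by
    have hc := continuousAt_extChartAt_symm (I := 𝓡 (2 * n)) x
    rw [ContinuousAt, hx] at hc
    filter_upwards [hc.eventually h] with y hy
    rw [inChart, inChart, hy]
  rw [dTw, dTw, h.self_of_nhds, d, d, extD, extD]
  congr 2
  refine Finset.sum_congr rfl fun i _ => ?_
  congr 1
  refine Finset.sum_congr rfl fun j _ => ?_
  congr 2
  refine Filter.EventuallyEq.fderiv_eq ?_
  filter_upwards [hy] with y hy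
  rw [hy]

variable [IsManifold (𝓡 (2 * n)) ∞ M] [T2Space M]

/-- Multiply by a bump function supported in `U` and equal to one near `x`. This is what makes a
commutation hypothesis on global forms usable for local spinors. -/
theorem FormSmoothOn.exists_global {U : Set M} (hU : IsOpen U) {x : M} (hx : x ∈ U)
    {τ : CField n M} (h : FormSmoothOn U τ) :
    ∃ σ : CField n M, FormSmoothOn Set.univ σ ∧ ∀ᶠ z in nhds x, σ z = τ z := by
  obtain ⟨f, -, hf⟩ := (SmoothBumpFunction.nhds_basis_tsupport (I := 𝓡 (2 * n)) x).mem_iff.mp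
    (hU.mem_nhds hx)
  refine ⟨fun z => f z • τ z, fun p => ?_, ?_⟩
  · have hin : ∀ y, inChart (fun z => f z • τ z) p y =
        f ((extChartAt (𝓡 (2 * n)) p).symm y) • inChart τ p y :=
      fun y => LinearMap.map_smul_of_tower _ _ _
    refine smoothOn_chartDomain_of_locally fun y _ => ?_
    by_cases hy : (extChartAt (𝓡 (2 * n)) p).symm y ∈ U
    · refine ⟨U, hU, hy, ?_⟩
      rw [Set.univ_inter]
      have hfs : ContDiffOn ℝ ∞ (fun y => f ((extChartAt (𝓡 (2 * n)) p).symm y))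
          (chartDomain n p U) := by
        rw [← contMDiffOn_iff_contDiffOn]
        exact f.contMDiff.comp_contMDiffOn
          ((contMDiffOn_extChartAt_symm p).mono fun y hy => hy.1)
      exact (SmoothOn.smul hfs (h p)).congr fun y _ => hin y
    · refine ⟨(tsupport f)ᶜ, (isClosed_tsupport f).isOpen_compl, fun hy' => hy (hf hy'), ?_⟩
      refine (smoothOn_const 0).congr fun z hz => ?_
      rw [hin, image_eq_zero_of_notMem_tsupport hz.2.2, zero_smul]
  · filter_upwards [f.eventuallyEq_one] with z hz
    rw [hz, Pi.one_apply, one_smul]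

end Locality

/-! ### Two linear identities used for the connection terms and the curvature form. -/

section Linear

variable {V W : Type*} [AddCommGroup V] [Module ℝ V] [AddCommGroup W] [Module ℝ W]

theorem spinMap_act_add_spinC [FiniteDimensional ℝ V] (A : V ≃ₗ[ℝ] W) {b : RForm V}
    (hb : b ∈ ⋀[ℝ]^2 (Module.Dual ℝ V)) (e : GTC W)
    (N : CliffordAlgebra (QuadraticForm.dualProd ℝ W)) (τ : CForm W) :
    spinMap A.toLinearMap b (act e τ + spinC N τ) =
      act (LinearMap.baseChange ℂ (gtMap A b) e) (spinMap A.toLinearMap b τ) +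
        spinC (CliffordAlgebra.map (gtIsometry A hb) N) (spinMap A.toLinearMap b τ) := by
  rw [map_add, spinMap_act A hb, spinMap_spinC A hb]

theorem reC_pullC_add_add_smul (A : V →ₗ[ℝ] W) (c : ℂ) (σ τ : CForm W) (r : ℝ) (α : RForm W) :
    reC _ (c • pullC A σ + c • pullC A τ) + r • pullR A α =
      pullR A (reC _ (c • σ + c • τ) + r • α) := by
  have h : ∀ t, reC _ (pullC A t) = pullR A (reC _ t) := reC_baseChange _
  rw [← map_smul, ← map_smul, ← map_add, h, map_add (pullR A), map_smul (pullR A)]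

end Linear

/-! ### Transport of trivializations, connection terms and admissible curvature values by `g`. -/

section Invariance

variable {n : ℕ} {M : Type*} [TopologicalSpace M] [ChartedSpace (EuclideanSpace ℝ (Fin (2 * n))) M]

/-- The action of `g = e^b F` on fields of endomorphisms of `T ⊕ T^*`. -/
def jSmul (g : ExtDiffeo n M) (J : JField n M) : JField n M := fun x =>
  gtConj (dF g.F x) (g.b x) (J (g.F x))

theorem pullback_apply (F : M ≃ₘ⟮𝓡 (2 * n), 𝓡 (2 * n)⟯ M) (α : RField n M) (x : M) :
    pullback F α x = pullR (dF F x).toLinearMap (α (F x)) := by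
  rw [dF_toLinearMap]
  rfl

theorem conjF_smul (g : ExtDiffeo n M) (τ : CField n M) :
    conjF (g.smul τ) = g.smul (conjF τ) := by
  funext x
  rw [smul_apply, conjF, smul_apply, conjC_spinMap, conjF]

theorem actF_smul (g : ExtDiffeo n M) (e : GTField n M) (τ : CField n M) :
    actF (gtSmul g e) (g.smul τ) = g.smul (actF e τ) := by
  funext x
  rw [smul_apply, actF, smul_apply]
  exact (spinMap_act (dF g.F x) (g.isForm.degree x) (e (g.F x)) (τ (g.F x))).symm

theorem IsAlmostGK.jSmul (g : ExtDiffeo n M) {J₁ J₂ : JField n M}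
    (hJ : ∀ x, IsAlmostGK (J₁ x) (J₂ x)) (x : M) : IsAlmostGK (jSmul g J₁ x) (jSmul g J₂ x) :=
  (hJ (g.F x)).gtConj _ (g.isForm.degree x)

theorem conjC_gtSmul_eq_neg (g : ExtDiffeo n M) {e : GTField n M} {x : M}
    (h : conjC _ (e (g.F x)) = -e (g.F x)) : conjC _ (gtSmul g e x) = -gtSmul g e x := by
  have := conjC_baseChange (gtMap (dF g.F x) (g.b x)) (e (g.F x))
  rw [h, map_neg] at this
  exact this

theorem pairingC_gtSmul (g : ExtDiffeo n M) (e f : GTField n M) (x : M) :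
    pairingC (gtSmul g e x) (gtSmul g f x) = pairingC (e (g.F x)) (f (g.F x)) :=
  pairingC_gtMap _ (g.isForm.degree x) _ _

theorem spinPairing_smul (g : ExtDiffeo n M) (σ τ : CField n M) (x : M) :
    spinPairing (g.smul σ x) (g.smul τ x) =
      pullC (dF g.F x).toLinearMap (spinPairing (σ (g.F x)) (τ (g.F x))) := by
  rw [smul_apply, smul_apply, spinPairing_spinMap (dF g.F x) (g.isForm.degree x)]

theorem smul_eq_act_add_spinC (g : ExtDiffeo n M) {σ τ : CField n M} {e : GTField n M} {x : M}
    {N : CliffordAlgebra (QuadraticForm.dualProd ℝ (T n (g.F x)))}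
    (h : σ (g.F x) = act (e (g.F x)) (τ (g.F x)) + spinC N (τ (g.F x))) :
    g.smul σ x = act (gtSmul g e x) (g.smul τ x) +
      spinC (CliffordAlgebra.map (gtIsometry (dF g.F x) (g.isForm.degree x)) N) (g.smul τ x) := by
  rw [smul_apply, smul_apply, h]
  exact spinMap_act_add_spinC (dF g.F x) (g.isForm.degree x) _ N _

/-- `g` commutes with `d_H` on globally defined smooth forms. -/
def CommutesWith (H : RField n M) (g : ExtDiffeo n M) : Prop :=
  ∀ τ : CField n M, FormSmoothOn Set.univ τ → dTw H (g.smul τ) = g.smul (dTw H τ)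

variable [IsManifold (𝓡 (2 * n)) ∞ M]

theorem IsTrivialization.smul (g : ExtDiffeo n M) {U : Set M} {φ : CField n M} {J : JField n M}
    {vol : RField n M} (h : IsTrivialization U φ J vol) :
    IsTrivialization (g.F ⁻¹' U) (g.smul φ) (jSmul g J) (pullback g.F vol) where
  smooth := h.smooth.smul g
  pure x hx := by
    rw [smul_apply]
    exact (h.pure _ hx).spinMap _ (g.isForm.degree x)
  nondegenerate x hx := by
    rw [smul_apply]
    exact (h.nondegenerate _ hx).spinMap _ (g.isForm.degree x)
  induces x hx := by
    rw [smul_apply]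
    exact (h.induces _ hx).spinMap _ (g.isForm.degree x)
  normalized x hx := by
    rw [smul_apply, conjC_spinMap, spinPairing_spinMap _ (g.isForm.degree x), ← map_smul,
      h.normalized _ hx, pullC_ofR, pullback_apply]

variable [T2Space M]

/-- Near `F x` the local form agrees with a global one, and both sides depend only on that germ. -/
theorem CommutesWith.dTw_smul {H : RField n M} {g : ExtDiffeo n M} (hg : CommutesWith H g)
    {U : Set M} (hU : IsOpen U) {τ : CField n M} (hτ : FormSmoothOn U τ) {x : M}
    (hx : g.F x ∈ U) : dTw H (g.smul τ) x = g.smul (dTw H τ) x := by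
  obtain ⟨σ, hσ, hστ⟩ := hτ.exists_global hU hx
  have h1 : ∀ᶠ z in nhds x, g.smul σ z = g.smul τ z := by
    filter_upwards [g.F.continuous.continuousAt.eventually hστ] with z hz
    rw [smul_apply, smul_apply, hz]
  rw [← dTw_congr H h1, hg σ hσ, smul_apply, smul_apply, dTw_congr H hστ]

/-- Commutation with `d_H` is used twice, for `e · τ` and for `τ`; the remaining actions of `e` are
intertwined pointwise. -/
theorem CommutesWith.lieTw_smul {H : RField n M} {g : ExtDiffeo n M} (hg : CommutesWith H g)
    {U : Set M} (hU : IsOpen U) {e : GTField n M} (he : GTSmoothOn U e) {τ : CField n M}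
    (hτ : FormSmoothOn U τ) {x : M} (hx : g.F x ∈ U) :
    lieTw H (gtSmul g e) (g.smul τ) x = g.smul (lieTw H e τ) x := by
  have h : act (gtSmul g e x) (spinMap (dF g.F x).toLinearMap (g.b x) (dTw H τ (g.F x))) =
      spinMap (dF g.F x).toLinearMap (g.b x) (act (e (g.F x)) (dTw H τ (g.F x))) :=
    (spinMap_act (dF g.F x) (g.isForm.degree x) _ _).symm
  rw [lieTw, actF_smul, hg.dTw_smul hU (FormSmoothOn.actF he hτ) hx, hg.dTw_smul hU hτ hx,
    smul_apply, smul_apply, smul_apply, h]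
  exact (map_add _ _ _).symm

theorem IsConnectionTerm.smul {H : RField n M} {g : ExtDiffeo n M} (hg : CommutesWith H g)
    {U : Set M} (hU : IsOpen U) {φ : CField n M} (hφ : FormSmoothOn U φ) {J : JField n M}
    {η : GTField n M} (h : IsConnectionTerm H U φ J η) :
    IsConnectionTerm H (g.F ⁻¹' U) (g.smul φ) (jSmul g J) (gtSmul g η) where
  smooth := GTSmoothOn.gtSmul g h.smooth
  imaginary x hx := conjC_gtSmul_eq_neg g (h.imaginary (g.F x) hx)
  eq x hx := by
    obtain ⟨N, hN, hd⟩ := h.eq (g.F x) hx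
    refine ⟨CliffordAlgebra.map (gtIsometry (dF g.F x) (g.isForm.degree x)) N,
      map_mem_nijenhuisSpace (dF g.F x) (g.isForm.degree x) hN, ?_⟩
    rw [hg.dTw_smul hU hφ hx]
    exact smul_eq_act_add_spinC g hd

theorem CommutesWith.spinPairing_lieTw_smul {H : RField n M} {g : ExtDiffeo n M}
    (hg : CommutesWith H g) {U : Set M} (hU : IsOpen U) {e : GTField n M} (he : GTSmoothOn U e)
    {τ : CField n M} (hτ : FormSmoothOn U τ) {x : M} (hx : g.F x ∈ U) :
    spinPairing (g.smul τ x) (lieTw H (gtSmul g e) (conjF (g.smul τ)) x) =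
      pullC (dF g.F x).toLinearMap
        (spinPairing (τ (g.F x)) (lieTw H e (conjF τ) (g.F x))) := by
  rw [conjF_smul, hg.lieTw_smul hU he hτ.conjF hx, spinPairing_smul]

theorem CommutesWith.curvatureForm_smul {H : RField n M} {g : ExtDiffeo n M}
    (hg : CommutesWith H g) {U : Set M} (hU : IsOpen U) {φ ψ : CField n M}
    (hφ : FormSmoothOn U φ) (hψ : FormSmoothOn U ψ) {η ζ : GTField n M} (hη : GTSmoothOn U η)
    (hζ : GTSmoothOn U ζ) (vol : RField n M) {x : M} (hx : g.F x ∈ U) :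
    curvatureForm H (pullback g.F vol) (g.smul φ) (g.smul ψ) (gtSmul g η) (gtSmul g ζ) x =
      pullR (dF g.F x).toLinearMap (curvatureForm H vol φ ψ η ζ (g.F x)) := by
  refine Eq.trans (congrArg₂ (· + ·) ?_ ?_) (reC_pullC_add_add_smul (dF g.F x).toLinearMap
    (Complex.I ^ n)⁻¹ (spinPairing (ψ (g.F x)) (lieTw H η (conjF ψ) (g.F x)))
    (spinPairing (φ (g.F x)) (lieTw H ζ (conjF φ) (g.F x)))
    (2 * (pairingC (ζ (g.F x)) (η (g.F x))).re) (vol (g.F x)))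
  · exact congrArg₂ (fun σ τ : CForm (T n x) => reC _ ((Complex.I ^ n)⁻¹ • σ +
      (Complex.I ^ n)⁻¹ • τ)) (hg.spinPairing_lieTw_smul hU hη hψ hx)
        (hg.spinPairing_lieTw_smul hU hζ hφ hx)
  · exact congrArg₂ (fun (c : ℂ) (α : RForm (T n x)) => (2 * c.re) • α) (pairingC_gtSmul g ζ η x)
      (pullback_apply g.F vol x)

theorem IsScalarCurvatureAt.smul {H : RField n M} {g : ExtDiffeo n M} (hg : CommutesWith H g)
    {J₁ J₂ : JField n M} {vol : RField n M} {x : M} {s : ℝ}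
    (h : IsScalarCurvatureAt H J₁ J₂ vol (g.F x) s) :
    IsScalarCurvatureAt H (jSmul g J₁) (jSmul g J₂) (pullback g.F vol) x s := by
  obtain ⟨U, φ, ψ, η, ζ, hU, hx, hφ, hψ, hη, hζ, hs⟩ := h
  refine ⟨g.F ⁻¹' U, g.smul φ, g.smul ψ, gtSmul g η, gtSmul g ζ, hU.preimage g.F.continuous, hx,
    hφ.smul g, hψ.smul g, hη.smul hg hU hφ.smooth, hζ.smul hg hU hψ.smooth, ?_⟩
  rw [hg.curvatureForm_smul hU hφ.smooth hψ.smooth hη.smooth hζ.smooth vol hx, ← hs, map_smul,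
    pullback_apply]

end Invariance

/-! ### The inverse of `e^b F` and the invariance of the scalar curvature. -/

section Inverse

variable {n : ℕ} {M : Type*} [TopologicalSpace M] [ChartedSpace (EuclideanSpace ℝ (Fin (2 * n))) M]

/-- The chain rule for `F ∘ F⁻¹ = id`. The two sides live over the points `F (F⁻¹ y)` and `y`, so
they are compared in the model space, to which every tangent space unfolds. -/
theorem dF_dF_symm (F : M ≃ₘ⟮𝓡 (2 * n), 𝓡 (2 * n)⟯ M) (y : M) (v : T n y) :
    (dF F (F.symm y) (dF F.symm y v) : EuclideanSpace ℝ (Fin (2 * n))) = v := by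
  have hid : ∀ f : M → M, f = id →
      (mfderiv (𝓡 (2 * n)) (𝓡 (2 * n)) f y v : EuclideanSpace ℝ (Fin (2 * n))) = v := by
    rintro _ rfl
    rw [mfderiv_id]
    rfl
  have hc := mfderiv_comp y (F.mdifferentiable (by simp) (F.symm y))
    (F.symm.mdifferentiable (by simp) y)
  have h := hid (F ∘ F.symm) (funext F.apply_symm_apply)
  rw [hc] at h
  have h1 := LinearMap.congr_fun (dF_toLinearMap F (F.symm y)) (dF F.symm y v)
  have h2 := LinearMap.congr_fun (dF_toLinearMap F.symm y) v
  refine Eq.trans h1 (Eq.trans ?_ h)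
  exact congrArg (mfderiv (𝓡 (2 * n)) (𝓡 (2 * n)) F (F.symm y)) h2

/-- To prove a property of `dF F (F.symm y)` and `dF F.symm y` one may assume that they are inverse
to each other, after replacing the point `F (F.symm y)` by `y`. -/
theorem dF_symm_induction (F : M ≃ₘ⟮𝓡 (2 * n), 𝓡 (2 * n)⟯ M) (y : M)
    (P : ∀ w : M, (T n (F.symm y) ≃ₗ[ℝ] T n w) → (T n y ≃ₗ[ℝ] T n (F.symm y)) → Prop)
    (h : ∀ A : T n (F.symm y) ≃ₗ[ℝ] T n y, P y A A.symm) :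
    P (F (F.symm y)) (dF F (F.symm y)) (dF F.symm y) := by
  have key : ∀ (w : M) (A : T n (F.symm y) ≃ₗ[ℝ] T n w), w = y →
      (∀ v : T n y, (A (dF F.symm y v) : EuclideanSpace ℝ (Fin (2 * n))) = v) →
      P w A (dF F.symm y) := by
    rintro w A rfl hA
    have : dF F.symm w = A.symm :=
      LinearEquiv.ext fun v => (LinearEquiv.eq_symm_apply A).mpr (hA v)
    rw [this]
    exact h A
  exact key _ _ (F.apply_symm_apply y) (dF_dF_symm F y)

theorem pullback_symm_pullback (F : M ≃ₘ⟮𝓡 (2 * n), 𝓡 (2 * n)⟯ M) (α : RField n M) :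
    pullback F.symm (pullback F α) = α := by
  funext y
  rw [pullback_apply, pullback_apply]
  refine dF_symm_induction F y
    (fun w A B => pullR B.toLinearMap (pullR A.toLinearMap (α w)) = α y) fun A => ?_
  rw [pullR_comp, LinearEquiv.comp_symm, pullR_id]

theorem isRealForm_zero (k : ℕ) : IsRealForm k (0 : RField n M) where
  degree _ := Submodule.zero_mem _
  smooth p := (smoothOn_const 0).congr fun y _ => by
    change pullC (dChartInv p y) (ofR 0) = 0
    rw [pullC_ofR, map_zero, ofR, TensorProduct.tmul_zero]

variable [IsManifold (𝓡 (2 * n)) ∞ M]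

theorem isRealForm_inv (g : ExtDiffeo n M) : IsRealForm 2 (fun y : M =>
    -pullR (dF g.F.symm y).toLinearMap (g.b (g.F.symm y))) where
  degree y := neg_twoForm (pullR_mem _ (g.isForm.degree _))
  smooth p := by
    -- With zero `b`-field, `e^0 = 1` and the action is the plain pullback, so `FormSmoothOn.smul`
    -- already gives smoothness.
    let F₀ : ExtDiffeo n M := ⟨g.F.symm, 0, isRealForm_zero 2⟩
    have hz : ∀ z, ofR (-pullR (dF g.F.symm z).toLinearMap (g.b (g.F.symm z))) =
        -(F₀.smul (fun x => ofR (g.b x)) z) := by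
      intro z
      have h0 : F₀.smul (fun x => ofR (g.b x)) z = ofR (IsNilpotent.exp (0 : RForm (T n z))) *
          ofR (pullR (dF g.F.symm z).toLinearMap (g.b (g.F.symm z))) :=
        (smul_apply F₀ _ z).trans (spinMap_eq _ _ _)
      rw [h0, IsNilpotent.exp_zero, ofR, ofR, ofR, TensorProduct.tmul_neg,
        ← Algebra.TensorProduct.one_def, one_mul]
    refine (((g.isForm.smooth.smul F₀) p).linear (-LinearMap.id)).congr fun y _ => ?_
    rw [inChart, hz]
    exact map_neg _ _

/-- The inverse of `e^b F`. -/
def inv (g : ExtDiffeo n M) : ExtDiffeo n M where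
  F := g.F.symm
  b y := -pullR (dF g.F.symm y).toLinearMap (g.b (g.F.symm y))
  isForm := isRealForm_inv g

theorem inv_smul_smul (g : ExtDiffeo n M) (τ : CField n M) : (inv g).smul (g.smul τ) = τ := by
  funext y
  rw [smul_apply, smul_apply]
  exact dF_symm_induction g.F y (fun w A B => spinMap B.toLinearMap
    (-pullR B.toLinearMap (g.b (g.F.symm y)))
      (spinMap A.toLinearMap (g.b (g.F.symm y)) (τ w)) = τ y)
    fun A => spinMap_symm_spinMap A (g.isForm.degree _) _

theorem jSmul_inv_jSmul (g : ExtDiffeo n M) (J : JField n M) : jSmul (inv g) (jSmul g J) = J := by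
  funext y
  exact dF_symm_induction g.F y (fun w A B => gtConj B
    (-pullR B.toLinearMap (g.b (g.F.symm y)))
      (gtConj A (g.b (g.F.symm y)) (J w)) = J y)
    fun A => gtConj_symm_gtConj A (g.isForm.degree _) _

theorem smul_inv_smul (g : ExtDiffeo n M) (τ : CField n M) : g.smul ((inv g).smul τ) = τ := by
  funext x
  -- The other composite is already the identity, so the claim follows by cancelling the injective
  -- action of the inverse at `y`.
  obtain ⟨y, rfl⟩ := g.F.symm.surjective x
  have h := congrFun (inv_smul_smul g ((inv g).smul τ)) y
  rw [smul_apply (inv g) (g.smul ((inv g).smul τ)) y, smul_apply (inv g) τ y] at h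
  exact spinMap_injective _ ((inv g).isForm.degree y) h

theorem CommutesWith.inv {H : RField n M} {g : ExtDiffeo n M} (hg : CommutesWith H g) :
    CommutesWith H (inv g) := by
  intro τ hτ
  have h := hg _ (hτ.smul (GenKahler.inv g))
  rw [smul_inv_smul] at h
  rw [h, inv_smul_smul]

/-- The converse is the forward transport applied to the inverse of `g`, which also commutes with
`d_H` and undoes the transport of the structures and the volume form. -/
theorem isScalarCurvatureAt_smul_iff [T2Space M] {H : RField n M} {g : ExtDiffeo n M}
    (hg : CommutesWith H g) (J₁ J₂ : JField n M) (vol : RField n M) (x : M) (s : ℝ) :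
    IsScalarCurvatureAt H (jSmul g J₁) (jSmul g J₂) (pullback g.F vol) x s ↔
      IsScalarCurvatureAt H J₁ J₂ vol (g.F x) s := by
  refine ⟨fun h => ?_, IsScalarCurvatureAt.smul hg⟩
  have hx : (inv g).F (g.F x) = x := g.F.symm_apply_apply x
  -- The point is rewritten as the image of `F x` under the inverse, the form in which the forward
  -- transport accepts it.
  rw [← hx] at h
  have h' := IsScalarCurvatureAt.smul hg.inv h
  rw [jSmul_inv_jSmul, jSmul_inv_jSmul] at h'
  exact pullback_symm_pullback g.F vol ▸ h'

/-- The two predicates on real numbers are equal, hence so are the values that `Classical.epsilon`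
selects. -/
theorem scalarCurvature_smul [T2Space M] {H : RField n M} {g : ExtDiffeo n M}
    (hg : CommutesWith H g) (J₁ J₂ : JField n M) (vol : RField n M) (x : M) :
    scalarCurvature H (jSmul g J₁) (jSmul g J₂) (pullback g.F vol) x =
      scalarCurvature H J₁ J₂ vol (g.F x) :=
  congrArg Classical.epsilon
    (funext fun s => propext (isScalarCurvatureAt_smul_iff hg J₁ J₂ vol x s))

end Inverse

end GenKahler

end

/-! ### Equivariance of the scalar curvature under extended diffeomorphisms. -/

theorem mainTheorem8 {n : ℕ} {M : Type*} [TopologicalSpace M] [T2Space M] [CompactSpace M]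
    [ChartedSpace (EuclideanSpace ℝ (Fin (2 * n))) M] [IsManifold (𝓡 (2 * n)) ∞ M]
    (vol : GenKahler.RField n M) (hvol : GenKahler.IsVolumeForm vol)
    (H : GenKahler.RField n M) (hH : GenKahler.IsClosedThreeForm H)
    (J₁ J₂ : GenKahler.JField n M) (hJ : ∀ x, GenKahler.IsAlmostGK (J₁ x) (J₂ x))
    {ι : Type*} (U : ι → Set M) (hU : ∀ a, IsOpen (U a)) (hcover : ⋃ a, U a = Set.univ)
    (φ ψ : ι → GenKahler.CField n M)
    (hφ : ∀ a, GenKahler.IsTrivialization (U a) (φ a) J₁ vol)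
    (hψ : ∀ a, GenKahler.IsTrivialization (U a) (ψ a) J₂ vol)
    (g : GenKahler.ExtDiffeo n M) (hg : g ∈ GenKahler.extDiff₀ H) :
    ∃ gJ₁ gJ₂ : GenKahler.JField n M,
      (∀ a, GenKahler.IsTrivialization (g.F ⁻¹' U a) (g.smul (φ a)) gJ₁
        (GenKahler.pullback g.F vol)) ∧
      (∀ a, GenKahler.IsTrivialization (g.F ⁻¹' U a) (g.smul (ψ a)) gJ₂
        (GenKahler.pullback g.F vol)) ∧
      (∀ x, GenKahler.IsAlmostGK (gJ₁ x) (gJ₂ x)) ∧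
      (fun x => GenKahler.scalarCurvature H gJ₁ gJ₂ (GenKahler.pullback g.F vol) x •
          GenKahler.pullback g.F vol x) =
        GenKahler.pullback g.F (fun x => GenKahler.scalarCurvature H J₁ J₂ vol x • vol x) := by
  have hc : GenKahler.CommutesWith H g := hg.2
  refine ⟨GenKahler.jSmul g J₁, GenKahler.jSmul g J₂, fun a => (hφ a).smul g,
    fun a => (hψ a).smul g, GenKahler.IsAlmostGK.jSmul g hJ, funext fun x => ?_⟩
  rw [GenKahler.scalarCurvature_smul hc, GenKahler.pullback_apply, GenKahler.pullback_apply,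
    map_smul]
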